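/- Let $(M,g)$ be a smooth Lorentzian manifold of dimension $n\ge 3$, with signature $(-,+,\dots,+)$. Call $(M,g)$ \emph{twisted} if every point has a coordinate neighbourhood $I\times U$, with $I\subseteq\mathbb R$ an open interval and $U\subseteq\mathbb R^{n-1}$ open, on which $$ds^2=-dt^2+f(t,x)^2\,g^*_{\mu\nu}(x)\,dx^\mu dx^\nu ,$$ where $f>0$ is smooth and $g^*$ is a smooth Riemannian metric on $U$. Call $(M,g)$ a \emph{generalized Robertson--Walker (GRW) spacetime} if every point has such a coordinate neighbourhood in which $f=f(t)$ depends on $t$ only (constant $f$ is allowed in both definitions). Let $(M,g)$ be twisted, and let $u$ be a smooth time-like unit torse-forming vector field on $M$ with smooth scalar $\varphi$, i.e. $$u^ku_k=-1,\qquad \nabla_iu_j=\varphi\,(u_iu_j+g_{ij}),$$ where $\nabla$ is the Levi-Civita connection. Put $h_i{}^k=u_iu^k+\delta_i^k$. Then the following are equivalent: 1. $(M,g)$ is a GRW spacetime; 2. the spatial gradient of $\varphi$ vanishes: $v_i=h_i{}^k\nabla_k\varphi=0$ on $M$; 3. $u$ is an eigenvector of the Ricci tensor at every point: $R_{jl}u^l=\xi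 u_j$ for some function $\xi$ on $M$. -/

import Mathlib

open scoped Manifold ContDiff Bundle Topology

noncomputable section

namespace LorentzGeometry

/-- The coordinate space of an `(m+1)`-dimensional spacetime; coordinate `0` is the time. -/
abbrev Coord (m : ℕ) : Type := EuclideanSpace ℝ (Fin (m + 1))

/-- The coordinate space of the `m`-dimensional space. -/
abbrev SpaceCoord (m : ℕ) : Type := EuclideanSpace ℝ (Fin m)

/-- The spatial part `(y¹, …, yᵐ)` of the coordinates `(y⁰, y¹, …, yᵐ)`. -/
def spacePart {m : ℕ} (y : Coord m) : SpaceCoord m := WithLp.toLp 2 (fun μ : Fin m => y μ.succ)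

/-- The partial derivative `∂ᵢ F` at `y`. -/
def pderiv {m : ℕ} (i : Fin (m + 1)) (F : Coord m → ℝ) (y : Coord m) : ℝ :=
  fderiv ℝ F y (EuclideanSpace.single i 1)

/-- A smooth Lorentzian metric (signature `(-, +, …, +)`) on a manifold of dimension `m + 1`. -/
structure LorentzMetric (m : ℕ) (M : Type*) [TopologicalSpace M] [ChartedSpace (Coord m) M]
    [IsManifold (𝓡 (m + 1)) ∞ M] where
  /-- The bilinear form on each tangent space. -/
  val (x : M) : TangentSpace (𝓡 (m + 1)) x →L[ℝ] TangentSpace (𝓡 (m + 1)) x →L[ℝ] ℝ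
  symm (x : M) (X Y : TangentSpace (𝓡 (m + 1)) x) : val x X Y = val x Y X
  /-- Each tangent space has an orthonormal basis with one time-like and `m` space-like vectors. -/
  signature (x : M) : ∃ b : Module.Basis (Fin (m + 1)) ℝ (TangentSpace (𝓡 (m + 1)) x),
    ∀ i j, val x (b i) (b j) = if i = j then (if i = 0 then -1 else 1) else 0
  contMDiff : ContMDiff (𝓡 (m + 1)) ((𝓡 (m + 1)).prod 𝓘(ℝ, Coord m →L[ℝ] Coord m →L[ℝ] ℝ)) ∞
    (fun x ↦ Bundle.TotalSpace.mk' (Coord m →L[ℝ] Coord m →L[ℝ] ℝ)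
      (E := fun x : M ↦ TangentSpace (𝓡 (m + 1)) x →L[ℝ] TangentSpace (𝓡 (m + 1)) x →L[ℝ] ℝ)
      x (val x))

section

variable {m : ℕ} {M : Type*} [TopologicalSpace M] [ChartedSpace (Coord m) M]
  [IsManifold (𝓡 (m + 1)) ∞ M]

/-- A smooth vector field on `M`. -/
def IsSmoothField (u : ∀ x : M, TangentSpace (𝓡 (m + 1)) x) : Prop :=
  ContMDiff (𝓡 (m + 1)) (𝓡 (m + 1)).tangent ∞
    (fun x : M ↦ (⟨x, u x⟩ : TangentBundle (𝓡 (m + 1)) M))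

/-- The coordinate vector field `∂ᵢ` of the chart `e`, at the point with coordinates `y`. -/
def coordVec (e : OpenPartialHomeomorph M (Coord m)) (i : Fin (m + 1)) (y : Coord m) :
    TangentSpace (𝓡 (m + 1)) (e.symm y) :=
  mfderiv (𝓡 (m + 1)) (𝓡 (m + 1)) e.symm y
    (EuclideanSpace.single i (1 : ℝ) : Coord m)

/-- The matrix `(gᵢⱼ)` of the metric in the chart `e`, as a function of the coordinates. -/
def metricMatrix (g : LorentzMetric m M) (e : OpenPartialHomeomorph M (Coord m)) (y : Coord m) :
    Matrix (Fin (m + 1)) (Fin (m + 1)) ℝ :=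
  Matrix.of fun i j => g.val (e.symm y) (coordVec e i y) (coordVec e j y)

/-- The Christoffel symbol `Γᵏᵢⱼ = ½ gᵏˡ (∂ᵢ gⱼₗ + ∂ⱼ gᵢₗ - ∂ₗ gᵢⱼ)` of the Levi-Civita connection
in the chart `e`. -/
def christoffel (g : LorentzMetric m M) (e : OpenPartialHomeomorph M (Coord m))
    (k i j : Fin (m + 1)) (y : Coord m) : ℝ :=
  (1 / 2 : ℝ) * ∑ l, (metricMatrix g e y)⁻¹ k l *
    (pderiv i (fun z => metricMatrix g e z j l) y + pderiv j (fun z => metricMatrix g e z i l) y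
      - pderiv l (fun z => metricMatrix g e z i j) y)

/-- The Ricci tensor
`Rⱼₗ = ∂ₖ Γᵏⱼₗ - ∂ⱼ Γᵏₖₗ + Γᵏₖₚ Γᵖⱼₗ - Γᵏⱼₚ Γᵖₖₗ` in the chart `e`. -/
def ricci (g : LorentzMetric m M) (e : OpenPartialHomeomorph M (Coord m))
    (j l : Fin (m + 1)) (y : Coord m) : ℝ :=
  ∑ k, (pderiv k (christoffel g e k j l) y - pderiv j (christoffel g e k k l) y
    + ∑ p, (christoffel g e k k p y * christoffel g e p j l y
      - christoffel g e k j p y * christoffel g e p k l y))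

/-- The covariant components `uⱼ = g(u, ∂ⱼ)` of a vector field in the chart `e`. -/
def lowerComp (g : LorentzMetric m M) (u : ∀ x : M, TangentSpace (𝓡 (m + 1)) x)
    (e : OpenPartialHomeomorph M (Coord m)) (j : Fin (m + 1)) (y : Coord m) : ℝ :=
  g.val (e.symm y) (u (e.symm y)) (coordVec e j y)

/-- The contravariant components `uⁱ = gⁱʲ uⱼ` of a vector field in the chart `e`. -/
def upperComp (g : LorentzMetric m M) (u : ∀ x : M, TangentSpace (𝓡 (m + 1)) x)
    (e : OpenPartialHomeomorph M (Coord m)) (i : Fin (m + 1)) (y : Coord m) : ℝ :=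
  ∑ j, (metricMatrix g e y)⁻¹ i j * lowerComp g u e j y

/-- The components `∇ᵢ uⱼ = ∂ᵢ uⱼ - Γᵏᵢⱼ uₖ` of the covariant derivative in the chart `e`. -/
def covDeriv (g : LorentzMetric m M) (u : ∀ x : M, TangentSpace (𝓡 (m + 1)) x)
    (e : OpenPartialHomeomorph M (Coord m)) (i j : Fin (m + 1)) (y : Coord m) : ℝ :=
  pderiv i (lowerComp g u e j) y - ∑ k, christoffel g e k i j y * lowerComp g u e k y

/-- `u` is a time-like unit vector field: `g(u, u) = -1`. -/
def IsTimelikeUnit (g : LorentzMetric m M) (u : ∀ x : M, TangentSpace (𝓡 (m + 1)) x) : Prop :=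
  ∀ x, g.val x (u x) (u x) = -1

/-- `u` is torse-forming with scalar `φ`: in every coordinate system of the smooth structure,
`∇ᵢ uⱼ = φ (uᵢ uⱼ + gᵢⱼ)`. -/
def IsTorseForming (g : LorentzMetric m M) (u : ∀ x : M, TangentSpace (𝓡 (m + 1)) x)
    (φ : M → ℝ) : Prop :=
  ∀ e ∈ IsManifold.maximalAtlas (𝓡 (m + 1)) ∞ M, ∀ y ∈ e.target, ∀ i j,
    covDeriv g u e i j y =
      φ (e.symm y) * (lowerComp g u e i y * lowerComp g u e j y + metricMatrix g e y i j)

/-- `u` is an eigenvector of the Ricci tensor at every point: there is a function `ξ` on `M` with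
`Rⱼₗ uˡ = ξ uⱼ` in every coordinate system of the smooth structure. -/
def IsRicciEigenvector (g : LorentzMetric m M)
    (u : ∀ x : M, TangentSpace (𝓡 (m + 1)) x) : Prop :=
  ∃ ξ : M → ℝ, ∀ e ∈ IsManifold.maximalAtlas (𝓡 (m + 1)) ∞ M, ∀ y ∈ e.target, ∀ j,
    ∑ l, ricci g e j l y * upperComp g u e l y = ξ (e.symm y) * lowerComp g u e j y

/-- The projection `h X = X + g(u, X) u`, i.e. `hᵢᵏ = uᵢ uᵏ + δᵢᵏ`, on the orthogonal
complement of a time-like unit vector field `u`. -/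
def spatialProj (g : LorentzMetric m M) (u : ∀ x : M, TangentSpace (𝓡 (m + 1)) x) (x : M)
    (X : TangentSpace (𝓡 (m + 1)) x) : TangentSpace (𝓡 (m + 1)) x :=
  X + g.val x (u x) X • u x

/-- The spatial gradient `vᵢ = hᵢᵏ ∇ₖ φ`, as a covector: `v(X) = dφ(h X)`. -/
def spatialGradient (g : LorentzMetric m M) (u : ∀ x : M, TangentSpace (𝓡 (m + 1)) x)
    (φ : M → ℝ) (x : M) (X : TangentSpace (𝓡 (m + 1)) x) : ℝ :=
  mfderiv (𝓡 (m + 1)) 𝓘(ℝ, ℝ) φ x (spatialProj g u x X)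

/-- In the chart `e`, which identifies its source with `I × U` where `I` is an open interval and
`U` is an open set of `ℝᵐ`, the metric is `-dt² + f(t, x)² g*_{μν}(x) dx^μ dx^ν`, where `f > 0` is
smooth and `g*` is a smooth Riemannian metric on `U`. -/
def IsTwistedChart (g : LorentzMetric m M) (e : OpenPartialHomeomorph M (Coord m))
    (I : Set ℝ) (U : Set (SpaceCoord m)) (f : ℝ → SpaceCoord m → ℝ)
    (gs : SpaceCoord m → Matrix (Fin m) (Fin m) ℝ) : Prop :=
  e ∈ IsManifold.maximalAtlas (𝓡 (m + 1)) ∞ M ∧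
  IsOpen I ∧ I.OrdConnected ∧ IsOpen U ∧
  e.target = {y | y 0 ∈ I ∧ spacePart y ∈ U} ∧
  (∀ t ∈ I, ∀ x ∈ U, 0 < f t x) ∧
  ContDiffOn ℝ ∞ (fun p : ℝ × SpaceCoord m => f p.1 p.2) (I ×ˢ U) ∧
  (∀ x ∈ U, (gs x).PosDef) ∧
  (∀ μ ν, ContDiffOn ℝ ∞ (fun x => gs x μ ν) U) ∧
  ∀ y ∈ e.target,
    metricMatrix g e y 0 0 = -1 ∧
    (∀ μ : Fin m, metricMatrix g e y 0 μ.succ = 0) ∧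
    ∀ μ ν : Fin m, metricMatrix g e y μ.succ ν.succ =
      f (y 0) (spacePart y) ^ 2 * gs (spacePart y) μ ν

/-- A twisted Lorentzian manifold: around each point there are privileged coordinates with
`ds² = -dt² + f(t, x)² g*_{μν}(x) dx^μ dx^ν`. -/
def IsTwisted (g : LorentzMetric m M) : Prop :=
  ∀ x : M, ∃ e I U f gs, x ∈ e.source ∧ IsTwistedChart g e I U f gs

/-- A generalized Robertson–Walker spacetime: around each point there are privileged coordinates
with `ds² = -dt² + f(t)² g*_{μν}(x) dx^μ dx^ν`. -/
def IsGRW (g : LorentzMetric m M) : Prop :=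
  ∀ x : M, ∃ e I U, ∃ f : ℝ → ℝ, ∃ gs, x ∈ e.source ∧
    IsTwistedChart g e I U (fun t _ => f t) gs

end

end LorentzGeometry

end

/-!
Let `v = dφ + dφ(u) u♭` be the spatial gradient of `φ`. The theorem compares three conditions, and
`v = 0` is the hinge.

*Ricci tensor.* Contracting the Ricci identity for `u` and inserting `∇ᵢ uⱼ = φ (uᵢ uⱼ + gᵢⱼ)` gives
`Rⱼₗ uˡ = m (u(φ) + φ²) uⱼ - (m - 1) vⱼ` (`sum_ricci_mul_upperComp`). As `v` is orthogonal to `u` and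
`m ≥ 2`, the field `u` is an eigenvector exactly when `v = 0` (`isRicciEigenvector_iff`).

*Warped coordinates.* The coordinate field `∂ₜ` of a twisted chart is itself unit and torse-forming,
with scalar `H = ∂ₜf / f`, but it need not be parallel to `u`: constant curvature spaces carry many
such fields. The link between `u` and `∂ₜ` is the integrability condition `∂ₜ ∂_μ u_ν = ∂_μ ∂ₜ u_ν`,
which reads `u_μ ∂_ν H + (∂ₜφ u_μ - uₜ ∂_μ φ) u_ν = c g_μν`
(`TwistedTorseFormingCoords.exists_integrability`). If `H` has no spatial derivatives, or if `v = 0`,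
one of the two terms on the left vanishes, and the left-hand side has rank at most one, whereas the
spatial metric has rank `m ≥ 2`; hence both sides are zero. Consequently `v = 0` or `∂_ν H = 0`
respectively, except possibly where the spatial part of `u` vanishes. On an open set of such points
`H uₜ + φ = 0`, and differentiating this relation settles the remaining case
(`pderiv_scalar_parallel`, `pderiv_expansion_eq_zero`).

In a generalized Robertson–Walker chart `H` depends on `t` only, so `v = 0`. Conversely, `v = 0` makes
`∂ₜ log f` independent of `x`, so `f` is locally a product `a(t) b(x)`; absorbing `b²` into the spatial
metric turns the twisted chart, shrunk to a ball in the spatial directions, into a generalized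
Robertson–Walker chart (`IsTwistedChart.exists_warped`). No new coordinates have to be constructed.
-/

noncomputable section

namespace LorentzGeometry

/-! ### Partial derivatives, and a rank argument -/

section Calculus

variable {m : ℕ} {Ω : Set (Coord m)} {F F' : Coord m → ℝ} {y : Coord m}

lemma pderiv_add (i : Fin (m + 1)) (hF : DifferentiableAt ℝ F y) (hF' : DifferentiableAt ℝ F' y) :
    pderiv i (fun z => F z + F' z) y = pderiv i F y + pderiv i F' y := by
  simp [pderiv, fderiv_fun_add hF hF']

lemma pderiv_mul (i : Fin (m + 1)) (hF : DifferentiableAt ℝ F y) (hF' : DifferentiableAt ℝ F' y) :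
    pderiv i (fun z => F z * F' z) y = pderiv i F y * F' y + F y * pderiv i F' y := by
  simp [pderiv, fderiv_fun_mul hF hF']; ring

lemma pderiv_const_mul (i : Fin (m + 1)) (a : ℝ) (hF : DifferentiableAt ℝ F y) :
    pderiv i (fun z => a * F z) y = a * pderiv i F y := by
  simp [pderiv, fderiv_const_mul hF]

lemma pderiv_sub (i : Fin (m + 1)) (hF : DifferentiableAt ℝ F y) (hF' : DifferentiableAt ℝ F' y) :
    pderiv i (fun z => F z - F' z) y = pderiv i F y - pderiv i F' y := by
  simp [pderiv, fderiv_fun_sub hF hF']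

@[simp] lemma pderiv_const (i : Fin (m + 1)) (a : ℝ) :
    pderiv i (fun _ : Coord m => a) y = 0 := by
  simp [pderiv]

lemma pderiv_sum {ι : Type*} [Fintype ι] {F : ι → Coord m → ℝ} (i : Fin (m + 1))
    (hF : ∀ k, DifferentiableAt ℝ (F k) y) :
    pderiv i (fun z => ∑ k, F k z) y = ∑ k, pderiv i (F k) y := by
  simp [pderiv, fderiv_fun_sum (fun k _ => hF k)]

lemma pderiv_congr (i : Fin (m + 1)) (hΩ : IsOpen Ω) (hy : y ∈ Ω) (h : Set.EqOn F F' Ω) :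
    pderiv i F y = pderiv i F' y := by
  have : F =ᶠ[𝓝 y] F' := Filter.eventuallyEq_of_mem (hΩ.mem_nhds hy) h
  simp [pderiv, this.fderiv_eq]

lemma pderiv_eq_zero_of_forall_eq (i : Fin (m + 1)) (hΩ : IsOpen Ω) (hy : y ∈ Ω) {a : ℝ}
    (h : ∀ z ∈ Ω, F z = a) : pderiv i F y = 0 := by
  rw [pderiv_congr i hΩ hy (F' := fun _ => a) h, pderiv_const]

lemma ContDiffOn.differentiableAt_of_isOpen (hΩ : IsOpen Ω) (hF : ContDiffOn ℝ ∞ F Ω)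
    (hy : y ∈ Ω) : DifferentiableAt ℝ F y :=
  (hF.contDiffAt (hΩ.mem_nhds hy)).differentiableAt (by simp)

lemma contDiffOn_pderiv (i : Fin (m + 1)) (hΩ : IsOpen Ω) (hF : ContDiffOn ℝ ∞ F Ω) :
    ContDiffOn ℝ ∞ (pderiv i F) Ω :=
  (hF.fderiv_of_isOpen hΩ (m := ∞) (by simp)).clm_apply contDiffOn_const

lemma pderiv_comm (i j : Fin (m + 1)) (hΩ : IsOpen Ω) (hF : ContDiffOn ℝ ∞ F Ω) (hy : y ∈ Ω) :
    pderiv i (pderiv j F) y = pderiv j (pderiv i F) y := by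
  have hd : DifferentiableAt ℝ (fderiv ℝ F) y :=
    ((hF.fderiv_of_isOpen hΩ (m := ∞) (by simp)).contDiffAt (hΩ.mem_nhds hy)).differentiableAt
      (by simp)
  have hs : IsSymmSndFDerivAt ℝ F y :=
    (hF.contDiffAt (hΩ.mem_nhds hy)).isSymmSndFDerivAt
      (by rw [minSmoothness_of_isRCLikeNormedField]; exact WithTop.coe_le_coe.2 le_top)
  have key : ∀ a b : Fin (m + 1), pderiv a (pderiv b F) y =
      fderiv ℝ (fderiv ℝ F) y (EuclideanSpace.single a 1) (EuclideanSpace.single b 1) := by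
    intro a b
    unfold pderiv
    rw [fderiv_clm_apply hd (differentiableAt_const _)]
    simp
  rw [key, key, hs.eq]

end Calculus

/-- If a matrix of rank at most one is a multiple of a positive definite matrix of size at least
two, it vanishes. -/
lemma mul_eq_zero_of_eq_smul_posDef {m : ℕ} (hm : 2 ≤ m) {p q : Fin m → ℝ} {c : ℝ}
    {A : Matrix (Fin m) (Fin m) ℝ} (hA : A.PosDef) (h : ∀ μ ν, p μ * q ν = c * A μ ν)
    (μ ν : Fin m) : p μ * q ν = 0 := by
  by_cases hc : c = 0
  · simp [h, hc]
  · exfalso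
    have hv : Matrix.vecMulVec p q = c • A := by
      ext μ ν; simp [Matrix.vecMulVec_apply, h]
    have h1 := Matrix.rank_vecMulVec_le p q
    have h2 : (c • A).rank = Fintype.card (Fin m) := by
      apply Matrix.rank_of_isUnit
      rw [Matrix.isUnit_iff_isUnit_det, Matrix.det_smul]
      exact (IsUnit.mk0 _ (mul_ne_zero (pow_ne_zero _ hc) hA.det_pos.ne'))
    rw [hv, h2, Fintype.card_fin] at h1
    omega

/-! ### The contracted Ricci identity in coordinates -/

/-- The coordinate expression, on an open set `Ω`, of a nondegenerate metric `G` with a smooth unit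
time-like torse-forming field. The field is given by its covariant components `u` and its
contravariant components `w`. The Christoffel term of `∇ᵢ uⱼ` is written with the symbols of the
first kind, `Γᵏᵢⱼ uₖ = ½ (∂ᵢ gⱼₗ + ∂ⱼ gᵢₗ - ∂ₗ gᵢⱼ) uˡ`, so that the inverse metric does not
occur. -/
structure TorseFormingCoords {m : ℕ} (Ω : Set (Coord m))
    (G : Coord m → Matrix (Fin (m + 1)) (Fin (m + 1)) ℝ) (u w : Fin (m + 1) → Coord m → ℝ)
    (φ : Coord m → ℝ) : Prop where
  isOpen : IsOpen Ω
  smooth_metric : ∀ i j, ContDiffOn ℝ ∞ (fun y => G y i j) Ω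
  smooth_lower : ∀ i, ContDiffOn ℝ ∞ (u i) Ω
  smooth_upper : ∀ i, ContDiffOn ℝ ∞ (w i) Ω
  smooth_scalar : ContDiffOn ℝ ∞ φ Ω
  symm : ∀ y i j, G y i j = G y j i
  det_ne_zero : ∀ y ∈ Ω, (G y).det ≠ 0
  lower_eq : ∀ y ∈ Ω, ∀ j, u j y = ∑ l, G y j l * w l y
  unit : ∀ y ∈ Ω, ∑ i, u i y * w i y = -1
  torse : ∀ y ∈ Ω, ∀ i j, pderiv i (u j) y =
    ∑ l, (1 / 2 : ℝ) * (pderiv i (fun z => G z j l) y + pderiv j (fun z => G z i l) y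
      - pderiv l (fun z => G z i j) y) * w l y + φ y * (u i y * u j y + G y i j)

namespace TorseFormingCoords

variable {m : ℕ} {Ω : Set (Coord m)} {G : Coord m → Matrix (Fin (m + 1)) (Fin (m + 1)) ℝ}
  {u w : Fin (m + 1) → Coord m → ℝ} {φ : Coord m → ℝ} {y : Coord m}

lemma diff_metric (h : TorseFormingCoords Ω G u w φ) (hy : y ∈ Ω) (i j : Fin (m + 1)) :
    DifferentiableAt ℝ (fun y => G y i j) y :=
  ContDiffOn.differentiableAt_of_isOpen h.isOpen (h.smooth_metric i j) hy

lemma diff_lower (h : TorseFormingCoords Ω G u w φ) (hy : y ∈ Ω) (i : Fin (m + 1)) :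
    DifferentiableAt ℝ (u i) y :=
  ContDiffOn.differentiableAt_of_isOpen h.isOpen (h.smooth_lower i) hy

lemma diff_upper (h : TorseFormingCoords Ω G u w φ) (hy : y ∈ Ω) (i : Fin (m + 1)) :
    DifferentiableAt ℝ (w i) y :=
  ContDiffOn.differentiableAt_of_isOpen h.isOpen (h.smooth_upper i) hy

lemma diff_scalar (h : TorseFormingCoords Ω G u w φ) (hy : y ∈ Ω) : DifferentiableAt ℝ φ y :=
  ContDiffOn.differentiableAt_of_isOpen h.isOpen h.smooth_scalar hy

lemma pderiv_metric_symm (h : TorseFormingCoords Ω G u w φ) (k i j : Fin (m + 1)) :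
    pderiv k (fun z => G z i j) y = pderiv k (fun z => G z j i) y := by
  simp only [h.symm _ i j]

/-- A torse-forming field is closed. -/
lemma pderiv_lower_symm (h : TorseFormingCoords Ω G u w φ) (hy : y ∈ Ω) (i j : Fin (m + 1)) :
    pderiv i (u j) y = pderiv j (u i) y := by
  rw [h.torse y hy, h.torse y hy]
  congr 1
  · refine Finset.sum_congr rfl fun l _ => ?_
    rw [h.pderiv_metric_symm l i j]; ring
  · rw [h.symm y i j]; ring

/-- The torse-forming equation for the contravariant components. The numbers `Γ` are the
Christoffel symbols at a point, determined by lowering their first index. -/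
lemma pderiv_upper (h : TorseFormingCoords Ω G u w φ) (hy : y ∈ Ω)
    {Γ : Fin (m + 1) → Fin (m + 1) → Fin (m + 1) → ℝ}
    (hΓ : ∀ j i p, ∑ l, G y j l * Γ l i p = (1 / 2 : ℝ) * (pderiv i (fun z => G z p j) y
      + pderiv p (fun z => G z i j) y - pderiv j (fun z => G z i p) y)) (i l : Fin (m + 1)) :
    pderiv i (w l) y + ∑ p, Γ l i p * w p y =
      φ y * (u i y * w l y + if i = l then 1 else 0) := by
  set X : Fin (m + 1) → ℝ := fun l => pderiv i (w l) y + ∑ p, Γ l i p * w p y -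
      φ y * (u i y * w l y + if i = l then 1 else 0) with hX
  have hz : (G y).mulVec X = 0 := by
    ext j
    have e1 : pderiv i (u j) y =
        ∑ l, (pderiv i (fun z => G z j l) y * w l y + G y j l * pderiv i (w l) y) := by
      rw [pderiv_congr i h.isOpen hy (fun z hz => h.lower_eq z hz j), pderiv_sum]
      · exact Finset.sum_congr rfl fun l _ => pderiv_mul i (h.diff_metric hy j l) (h.diff_upper hy l)
      · exact fun l => (h.diff_metric hy j l).mul (h.diff_upper hy l)
    have e2 : ∑ l, G y j l * ∑ p, Γ l i p * w p y =
        ∑ p, (1 / 2 : ℝ) * (pderiv i (fun z => G z p j) y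
      + pderiv p (fun z => G z i j) y - pderiv j (fun z => G z i p) y) * w p y := by
      simp_rw [← hΓ, Finset.mul_sum, Finset.sum_mul]
      rw [Finset.sum_comm]
      exact Finset.sum_congr rfl fun l _ => Finset.sum_congr rfl fun p _ => by ring
    have e3 : ∑ l, G y j l * (φ y * (u i y * w l y + if i = l then 1 else 0)) =
        φ y * (u i y * u j y + G y i j) := by
      rw [h.lower_eq y hy j, h.symm y i j, mul_add, Finset.mul_sum, Finset.mul_sum]
      simp only [mul_add, Finset.sum_add_distrib]
      congr 1
      · exact Finset.sum_congr rfl fun l _ => by ring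
      · simp [mul_comm]
    have e4 := h.torse y hy i j
    simp only [Matrix.mulVec, dotProduct, hX, mul_sub, mul_add, Finset.sum_sub_distrib,
      Finset.sum_add_distrib, Pi.zero_apply]
    simp only [mul_add, Finset.sum_add_distrib] at e3
    rw [e2, e3]
    rw [e1, Finset.sum_add_distrib] at e4
    have e5 : ∑ p, (1 / 2 : ℝ) * (pderiv i (fun z => G z p j) y
        + pderiv p (fun z => G z i j) y - pderiv j (fun z => G z i p) y) * w p y
        + ∑ l, (1 / 2 : ℝ) * (pderiv i (fun z => G z j l) y + pderiv j (fun z => G z i l) y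
      - pderiv l (fun z => G z i j) y) * w l y = ∑ l, pderiv i (fun z => G z j l) y * w l y := by
      rw [← Finset.sum_add_distrib]
      refine Finset.sum_congr rfl fun l _ => ?_
      rw [h.pderiv_metric_symm i l j]; ring
    linarith
  have := congrFun (Matrix.eq_zero_of_mulVec_eq_zero (h.det_ne_zero y hy) hz) l
  simp only [hX, Pi.zero_apply] at this
  linarith

/-- The contracted Ricci identity: for a unit torse-forming field,
`Rⱼₗ uˡ = (uᵏ ∂ₖφ + m φ²) uⱼ - (m - 1) ∂ⱼφ`. -/
lemma ricci_contract (h : TorseFormingCoords Ω G u w φ) (hy : y ∈ Ω)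
    {Γ : Fin (m + 1) → Fin (m + 1) → Fin (m + 1) → Coord m → ℝ}
    (hΓs : ∀ k i j, ContDiffOn ℝ ∞ (Γ k i j) Ω) (hsymm : ∀ y k i j, Γ k i j y = Γ k j i y)
    (hΓ : ∀ y ∈ Ω, ∀ j i p, ∑ l, G y j l * Γ l i p y = (1 / 2 : ℝ) * (pderiv i (fun z => G z p j) y
      + pderiv p (fun z => G z i j) y - pderiv j (fun z => G z i p) y)) (j : Fin (m + 1)) :
    ∑ l, (∑ k, (pderiv k (Γ k j l) y - pderiv j (Γ k k l) y
      + ∑ p, (Γ k k p y * Γ p j l y - Γ k j p y * Γ p k l y))) * w l y =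
    (∑ k, w k y * pderiv k φ y + m * φ y ^ 2) * u j y - (m - 1) * pderiv j φ y := by
  have hN : ∀ z ∈ Ω, ∀ i l, pderiv i (w l) z + ∑ p, Γ l i p z * w p z =
      φ z * (u i z * w l z + if i = l then 1 else 0) :=
    fun z hz => h.pderiv_upper hz (hΓ z hz)
  have dΓ : ∀ k i j, DifferentiableAt ℝ (Γ k i j) y := fun k i j =>
    ContDiffOn.differentiableAt_of_isOpen h.isOpen (hΓs k i j) hy
  have dw : ∀ i k, DifferentiableAt ℝ (pderiv i (w k)) y := fun i k =>
    ContDiffOn.differentiableAt_of_isOpen h.isOpen (contDiffOn_pderiv i h.isOpen (h.smooth_upper k)) hy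
  have uu := h.diff_lower hy
  have ww := h.diff_upper hy
  have pp := h.diff_scalar hy
  -- The derivative of the torse-forming equation.
  have hD : ∀ k i l, pderiv k (pderiv i (w l)) y +
      ∑ p, (pderiv k (Γ l i p) y * w p y + Γ l i p y * pderiv k (w p) y) =
      pderiv k φ y * (u i y * w l y + if i = l then 1 else 0) +
      φ y * (pderiv k (u i) y * w l y + u i y * pderiv k (w l) y) := by
    intro k i l
    have e := pderiv_congr k h.isOpen hy (fun z hz => hN z hz i l)
    have dΓw : ∀ p, DifferentiableAt ℝ (fun z => Γ l i p z * w p z) y :=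
      fun p => (dΓ l i p).mul (ww p)
    have dS : DifferentiableAt ℝ (fun z => ∑ p, Γ l i p z * w p z) y :=
      .fun_sum fun p _ => dΓw p
    have duw : DifferentiableAt ℝ (fun z => u i z * w l z) y := (uu i).mul (ww l)
    have duw' : DifferentiableAt ℝ (fun z => u i z * w l z + if i = l then 1 else 0) y :=
      duw.add_const _
    rw [pderiv_add k (dw i l) dS, pderiv_sum k dΓw, pderiv_mul k pp duw',
      pderiv_add k duw (differentiableAt_const _), pderiv_const,
      pderiv_mul k (uu i) (ww l), add_zero] at e
    rw [← e]
    congr 1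
    exact Finset.sum_congr rfl fun p _ => (pderiv_mul k (dΓ l i p) (ww p)).symm
  -- The contribution of each value of the contracted index `k`.
  have key : ∀ k, ∑ l, (pderiv k (Γ k j l) y - pderiv j (Γ k k l) y
      + ∑ p, (Γ k k p y * Γ p j l y - Γ k j p y * Γ p k l y)) * w l y =
      pderiv k φ y * u j y * w k y + pderiv k φ y * (if j = k then 1 else 0)
        - pderiv j φ y * (u k y * w k y + 1) + φ y ^ 2 * u j y
        - φ y ^ 2 * u k y * (if j = k then 1 else 0) := by
    intro k
    have d1 := hD k j k
    have d2 := hD j k k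
    have n1 := hN y hy k k
    have n2 := hN y hy j k
    rw [pderiv_comm j k h.isOpen (h.smooth_upper k) hy] at d2
    have q : ∀ a b : Fin (m + 1), ∑ l, (∑ p, Γ k a p y * Γ p b l y) * w l y =
        φ y * (u b y * (∑ p, Γ k a p y * w p y) + Γ k a b y)
          - ∑ p, Γ k a p y * pderiv b (w p) y := by
      intro a b
      simp_rw [Finset.sum_mul]
      rw [Finset.sum_comm]
      have : ∀ p, ∑ l, Γ k a p y * Γ p b l y * w l y =
          φ y * (u b y * (Γ k a p y * w p y)) + φ y * (Γ k a p y * if b = p then 1 else 0)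
            - Γ k a p y * pderiv b (w p) y := by
        intro p
        simp_rw [mul_assoc, ← Finset.mul_sum]
        rw [show ∑ l, Γ p b l y * w l y = φ y * (u b y * w p y + if b = p then 1 else 0)
          - pderiv b (w p) y from by rw [← hN y hy b p]; ring]
        ring
      simp_rw [this]
      rw [Finset.sum_sub_distrib, Finset.sum_add_distrib, ← Finset.mul_sum, ← Finset.mul_sum,
        ← Finset.mul_sum]
      simp [mul_add]
    have q1 := q k j
    have q2 := q j k
    have c := h.pderiv_lower_symm hy k j
    rw [hsymm y k k j] at q1
    simp only [if_true] at d2 n1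
    have expand : ∑ l, (pderiv k (Γ k j l) y - pderiv j (Γ k k l) y
      + ∑ p, (Γ k k p y * Γ p j l y - Γ k j p y * Γ p k l y)) * w l y =
      ∑ l, pderiv k (Γ k j l) y * w l y - ∑ l, pderiv j (Γ k k l) y * w l y +
      (∑ l, (∑ p, Γ k k p y * Γ p j l y) * w l y - ∑ l, (∑ p, Γ k j p y * Γ p k l y) * w l y) := by
      simp only [Finset.sum_sub_distrib, add_mul, sub_mul, Finset.sum_add_distrib]
    rw [expand, q1, q2]
    rw [Finset.sum_add_distrib] at d1 d2
    rw [c] at d1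
    have n1' : ∑ p, Γ k k p y * w p y = φ y * (u k y * w k y + 1) - pderiv k (w k) y := by linarith
    have n2' : ∑ p, Γ k j p y * w p y =
      φ y * (u j y * w k y + if j = k then 1 else 0) - pderiv j (w k) y := by linarith
    rw [n1', n2']
    linear_combination d1 - d2
  have swap : ∑ l, (∑ k, (pderiv k (Γ k j l) y - pderiv j (Γ k k l) y
      + ∑ p, (Γ k k p y * Γ p j l y - Γ k j p y * Γ p k l y))) * w l y =
      ∑ k, ∑ l, (pderiv k (Γ k j l) y - pderiv j (Γ k k l) y
      + ∑ p, (Γ k k p y * Γ p j l y - Γ k j p y * Γ p k l y)) * w l y := by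
    simp_rw [Finset.sum_mul]
    rw [Finset.sum_comm]
  rw [swap, Finset.sum_congr rfl fun k _ => key k]
  have un := h.unit y hy
  simp only [Finset.sum_add_distrib, Finset.sum_sub_distrib, mul_add, ← Finset.mul_sum, un]
  simp only [mul_ite, mul_one, mul_zero, Finset.sum_ite_eq, Finset.mem_univ, if_true,
    Finset.sum_const, Finset.card_univ, Fintype.card_fin, nsmul_eq_mul]
  have : ∑ k, pderiv k φ y * u j y * w k y = (∑ k, w k y * pderiv k φ y) * u j y := by
    rw [Finset.sum_mul]; exact Finset.sum_congr rfl fun k _ => by ring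
  rw [this]
  push_cast
  ring

end TorseFormingCoords

/-! ### Torse-forming fields in twisted coordinates -/

/-- A torse-forming field `u` in coordinates in which the metric is `-dt² + f(t, x)² g*(x)`. The
function `f` enters through its logarithmic time derivative `H = ∂ₜf / f`, the expansion of the
coordinate field `∂ₜ`, which need not be parallel to `u`. -/
structure TwistedTorseFormingCoords {m : ℕ} (Ω : Set (Coord m))
    (G : Coord m → Matrix (Fin (m + 1)) (Fin (m + 1)) ℝ) (u w : Fin (m + 1) → Coord m → ℝ)
    (φ H : Coord m → ℝ) : Prop extends TorseFormingCoords Ω G u w φ where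
  metric_zero_zero : ∀ y ∈ Ω, G y 0 0 = -1
  metric_zero_succ : ∀ y ∈ Ω, ∀ μ : Fin m, G y 0 μ.succ = 0
  smooth_expansion : ContDiffOn ℝ ∞ H Ω
  pderiv_zero_metric : ∀ y ∈ Ω, ∀ μ ν : Fin m,
    pderiv 0 (fun z => G z μ.succ ν.succ) y = 2 * H y * G y μ.succ ν.succ
  posDef : ∀ y ∈ Ω, (Matrix.of fun μ ν : Fin m => G y μ.succ ν.succ).PosDef

namespace TwistedTorseFormingCoords

variable {m : ℕ} {Ω : Set (Coord m)} {G : Coord m → Matrix (Fin (m + 1)) (Fin (m + 1)) ℝ}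
  {u w : Fin (m + 1) → Coord m → ℝ} {φ H : Coord m → ℝ} {y : Coord m}

lemma diff_expansion (h : TwistedTorseFormingCoords Ω G u w φ H) (hy : y ∈ Ω) :
    DifferentiableAt ℝ H y :=
  ContDiffOn.differentiableAt_of_isOpen h.isOpen h.smooth_expansion hy

lemma metric_succ_zero (h : TwistedTorseFormingCoords Ω G u w φ H) (hy : y ∈ Ω) (μ : Fin m) :
    G y μ.succ 0 = 0 := by
  rw [h.symm, h.metric_zero_succ y hy]

lemma pderiv_metric_zero_zero (h : TwistedTorseFormingCoords Ω G u w φ H) (hy : y ∈ Ω)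
    (i : Fin (m + 1)) : pderiv i (fun z => G z 0 0) y = 0 :=
  pderiv_eq_zero_of_forall_eq i h.isOpen hy h.metric_zero_zero

lemma pderiv_metric_zero_succ (h : TwistedTorseFormingCoords Ω G u w φ H) (hy : y ∈ Ω)
    (i : Fin (m + 1)) (μ : Fin m) : pderiv i (fun z => G z 0 μ.succ) y = 0 :=
  pderiv_eq_zero_of_forall_eq i h.isOpen hy fun z hz => h.metric_zero_succ z hz μ

lemma pderiv_metric_succ_zero (h : TwistedTorseFormingCoords Ω G u w φ H) (hy : y ∈ Ω)
    (i : Fin (m + 1)) (μ : Fin m) : pderiv i (fun z => G z μ.succ 0) y = 0 :=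
  pderiv_eq_zero_of_forall_eq i h.isOpen hy fun _ hz => h.metric_succ_zero hz μ

lemma lower_zero (h : TwistedTorseFormingCoords Ω G u w φ H) (hy : y ∈ Ω) :
    u 0 y = -w 0 y := by
  rw [h.lower_eq y hy, Fin.sum_univ_succ]
  simp [h.metric_zero_zero y hy, h.metric_zero_succ y hy]

lemma lower_succ (h : TwistedTorseFormingCoords Ω G u w φ H) (hy : y ∈ Ω) (μ : Fin m) :
    u μ.succ y = ∑ l : Fin m, G y μ.succ l.succ * w l.succ y := by
  rw [h.lower_eq y hy, Fin.sum_univ_succ]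
  simp [h.metric_succ_zero hy]

/-- The time component of a unit time-like field does not vanish. -/
lemma lower_zero_ne_zero (h : TwistedTorseFormingCoords Ω G u w φ H) (hy : y ∈ Ω) :
    u 0 y ≠ 0 := by
  intro h0
  have hun := h.unit y hy
  rw [Fin.sum_univ_succ, h0] at hun
  have := (h.posDef y hy).posSemidef.dotProduct_mulVec_nonneg (fun μ : Fin m => w μ.succ y)
  have e : star (fun μ : Fin m => w μ.succ y) ⬝ᵥ
      ((Matrix.of fun μ ν : Fin m => G y μ.succ ν.succ).mulVec fun μ : Fin m => w μ.succ y) =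
      ∑ i : Fin m, u i.succ y * w i.succ y := by
    simp only [dotProduct, Matrix.mulVec, Matrix.of_apply, h.lower_succ hy]
    exact Finset.sum_congr rfl fun _ _ => mul_comm _ _
  rw [e] at this
  linarith

lemma pderiv_zero_lower_zero (h : TwistedTorseFormingCoords Ω G u w φ H) (hy : y ∈ Ω) :
    pderiv 0 (u 0) y = φ y * (u 0 y * u 0 y - 1) := by
  rw [h.torse y hy, Fin.sum_univ_succ]
  simp [h.metric_zero_zero y hy, h.pderiv_metric_zero_zero hy, h.pderiv_metric_zero_succ hy,
    sub_eq_add_neg]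

lemma pderiv_succ_lower_zero (h : TwistedTorseFormingCoords Ω G u w φ H) (hy : y ∈ Ω)
    (μ : Fin m) : pderiv μ.succ (u 0) y = (H y + φ y * u 0 y) * u μ.succ y := by
  rw [h.torse y hy, Fin.sum_univ_succ]
  simp only [h.pderiv_metric_zero_zero hy, h.pderiv_metric_zero_succ hy,
    h.pderiv_metric_succ_zero hy, h.metric_succ_zero hy, h.pderiv_zero_metric y hy]
  rw [add_mul, h.lower_succ hy μ, Finset.mul_sum, mul_assoc, Finset.sum_mul]
  simp only [add_zero, sub_zero, mul_zero, zero_mul, zero_add, Finset.mul_sum,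
    ← Finset.sum_add_distrib]
  exact Finset.sum_congr rfl fun l _ => by ring

lemma pderiv_zero_lower_succ (h : TwistedTorseFormingCoords Ω G u w φ H) (hy : y ∈ Ω)
    (μ : Fin m) : pderiv 0 (u μ.succ) y = (H y + φ y * u 0 y) * u μ.succ y := by
  rw [h.pderiv_lower_symm hy, h.pderiv_succ_lower_zero hy]

lemma pderiv_succ_lower_succ (h : TwistedTorseFormingCoords Ω G u w φ H) (hy : y ∈ Ω)
    (μ ν : Fin m) : pderiv μ.succ (u ν.succ) y =
      ∑ l : Fin m, (1 / 2 : ℝ) * (pderiv μ.succ (fun z => G z ν.succ l.succ) y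
        + pderiv ν.succ (fun z => G z μ.succ l.succ) y
        - pderiv l.succ (fun z => G z μ.succ ν.succ) y) * w l.succ y
      + (H y * u 0 y + φ y) * G y μ.succ ν.succ + φ y * (u μ.succ y * u ν.succ y) := by
  rw [h.torse y hy, Fin.sum_univ_succ]
  simp only [h.pderiv_metric_succ_zero hy, h.pderiv_zero_metric y hy, h.lower_zero hy]
  ring

lemma pderiv_zero_upper_succ (h : TwistedTorseFormingCoords Ω G u w φ H) (hy : y ∈ Ω)
    (l : Fin m) : pderiv 0 (w l.succ) y = (φ y * u 0 y - H y) * w l.succ y := by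
  have hz : (Matrix.of fun μ ν : Fin m => G y μ.succ ν.succ).mulVec
      (fun l => pderiv 0 (w l.succ) y - (φ y * u 0 y - H y) * w l.succ y) = 0 := by
    ext μ
    have dGw : ∀ l : Fin m, DifferentiableAt ℝ (fun z => G z μ.succ l.succ * w l.succ z) y :=
      fun l => (h.diff_metric hy _ _).mul (h.diff_upper hy _)
    have e := h.pderiv_zero_lower_succ hy μ
    rw [pderiv_congr 0 h.isOpen hy (fun z hz => h.lower_succ hz μ),
      pderiv_sum 0 dGw,
      Finset.sum_congr rfl fun l _ => pderiv_mul 0 (h.diff_metric hy _ _) (h.diff_upper hy l.succ)]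
      at e
    simp only [h.pderiv_zero_metric y hy, h.lower_succ hy, Finset.mul_sum] at e
    simp only [Matrix.mulVec, dotProduct, Matrix.of_apply, Pi.zero_apply]
    rw [← sub_eq_zero, ← Finset.sum_sub_distrib] at e
    rw [← e]
    exact Finset.sum_congr rfl fun l _ => by ring
  have := congrFun (Matrix.eq_zero_of_mulVec_eq_zero (h.posDef y hy).det_pos.ne' hz) l
  simp only [Pi.zero_apply] at this
  linarith

lemma pderiv_zero_pderiv_metric (h : TwistedTorseFormingCoords Ω G u w φ H) (hy : y ∈ Ω)
    (i : Fin (m + 1)) (μ ν : Fin m) :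
    pderiv 0 (pderiv i fun z => G z μ.succ ν.succ) y =
      2 * pderiv i H y * G y μ.succ ν.succ + 2 * H y * pderiv i (fun z => G z μ.succ ν.succ) y := by
  rw [pderiv_comm 0 i h.isOpen (h.smooth_metric _ _) hy,
    pderiv_congr i h.isOpen hy (fun z hz => h.pderiv_zero_metric z hz μ ν),
    pderiv_mul i ((h.diff_expansion hy).const_mul 2) (h.diff_metric hy _ _),
    pderiv_const_mul i 2 (h.diff_expansion hy)]

/-- The integrability condition `∂ₜ ∂_μ u_ν = ∂_μ ∂ₜ u_ν`. Its left-hand side has rank one in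
`(μ, ν)` as soon as one of its two terms is zero. -/
lemma exists_integrability (h : TwistedTorseFormingCoords Ω G u w φ H) (hy : y ∈ Ω) :
    ∃ c : ℝ, ∀ μ ν : Fin m, u μ.succ y * pderiv ν.succ H y +
      (pderiv 0 φ y * u μ.succ y - u 0 y * pderiv μ.succ φ y) * u ν.succ y =
        c * G y μ.succ ν.succ := by
  refine ⟨∑ l : Fin m, pderiv l.succ H y * w l.succ y - (pderiv 0 H y * u 0 y
    + H y * (φ y * (u 0 y * u 0 y - 1)) + pderiv 0 φ y + 2 * H y * (H y * u 0 y + φ y))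
    + (H y + φ y * u 0 y) * (H y * u 0 y + φ y), fun μ ν => ?_⟩
  have dG : ∀ i j, DifferentiableAt ℝ (fun z => G z i j) y := h.diff_metric hy
  have dpG : ∀ k i j, DifferentiableAt ℝ (pderiv k fun z => G z i j) y := fun k i j =>
    ContDiffOn.differentiableAt_of_isOpen h.isOpen
      (contDiffOn_pderiv k h.isOpen (h.smooth_metric i j)) hy
  have dw := h.diff_upper hy
  have du := h.diff_lower hy
  have dφ := h.diff_scalar hy
  have dH := h.diff_expansion hy
  -- The time derivative of the Christoffel symbols of the first kind.
  have dC : ∀ l : Fin m, DifferentiableAt ℝ (fun z => (1 / 2 : ℝ) *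
      (pderiv μ.succ (fun z => G z ν.succ l.succ) z + pderiv ν.succ (fun z => G z μ.succ l.succ) z
        - pderiv l.succ (fun z => G z μ.succ ν.succ) z)) y := fun l =>
    (((dpG _ _ _).fun_add (dpG _ _ _)).fun_sub (dpG _ _ _)).const_mul _
  have eC : ∀ l : Fin m, pderiv 0 (fun z => (1 / 2 : ℝ) *
      (pderiv μ.succ (fun z => G z ν.succ l.succ) z + pderiv ν.succ (fun z => G z μ.succ l.succ) z
        - pderiv l.succ (fun z => G z μ.succ ν.succ) z)) y =
      2 * H y * ((1 / 2 : ℝ) * (pderiv μ.succ (fun z => G z ν.succ l.succ) y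
        + pderiv ν.succ (fun z => G z μ.succ l.succ) y
        - pderiv l.succ (fun z => G z μ.succ ν.succ) y))
      + pderiv μ.succ H y * G y ν.succ l.succ + pderiv ν.succ H y * G y μ.succ l.succ
      - pderiv l.succ H y * G y μ.succ ν.succ := by
    intro l
    rw [pderiv_const_mul 0 _ (((dpG _ _ _).fun_add (dpG _ _ _)).fun_sub (dpG _ _ _)),
      pderiv_sub 0 ((dpG _ _ _).fun_add (dpG _ _ _)) (dpG _ _ _),
      pderiv_add 0 (dpG _ _ _) (dpG _ _ _)]
    simp only [h.pderiv_zero_pderiv_metric hy]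
    ring
  set C : Fin m → Coord m → ℝ := fun l z => (1 / 2 : ℝ) *
      (pderiv μ.succ (fun z => G z ν.succ l.succ) z + pderiv ν.succ (fun z => G z μ.succ l.succ) z
        - pderiv l.succ (fun z => G z μ.succ ν.succ) z) with hC
  have dCw : ∀ l : Fin m, DifferentiableAt ℝ (fun z => C l z * w l.succ z) y :=
    fun l => (dC l).mul (dw _)
  have dS : DifferentiableAt ℝ (fun z => ∑ l, C l z * w l.succ z) y := .fun_sum fun l _ => dCw l
  have dHu : DifferentiableAt ℝ (fun z => H z * u 0 z) y := dH.mul (du 0)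
  have dφu : DifferentiableAt ℝ (fun z => φ z * u 0 z) y := dφ.mul (du 0)
  have duu : DifferentiableAt ℝ (fun z => u μ.succ z * u ν.succ z) y := (du _).mul (du _)
  have dHuφ : DifferentiableAt ℝ (fun z => H z * u 0 z + φ z) y := dHu.fun_add dφ
  have dHuφG : DifferentiableAt ℝ (fun z => (H z * u 0 z + φ z) * G z μ.succ ν.succ) y :=
    dHuφ.mul (dG _ _)
  have dφuu : DifferentiableAt ℝ (fun z => φ z * (u μ.succ z * u ν.succ z)) y := dφ.mul duu
  have dSH : DifferentiableAt ℝ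
      (fun z => ∑ l, C l z * w l.succ z + (H z * u 0 z + φ z) * G z μ.succ ν.succ) y :=
    dS.fun_add dHuφG
  have e := pderiv_comm 0 μ.succ h.isOpen (h.smooth_lower ν.succ) hy
  rw [pderiv_congr 0 h.isOpen hy (fun z hz => h.pderiv_succ_lower_succ hz μ ν),
    pderiv_congr μ.succ h.isOpen hy (fun z hz => h.pderiv_zero_lower_succ hz ν)] at e
  change pderiv 0 (fun z => ∑ l, C l z * w l.succ z + (H z * u 0 z + φ z) * G z μ.succ ν.succ
    + φ z * (u μ.succ z * u ν.succ z)) y = _ at e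
  rw [pderiv_add 0 dSH dφuu, pderiv_add 0 dS dHuφG, pderiv_sum 0 dCw,
    pderiv_mul 0 dHuφ (dG _ _), pderiv_add 0 dHu dφ, pderiv_mul 0 dH (du 0), pderiv_mul 0 dφ duu,
    pderiv_mul 0 (du _) (du _), pderiv_mul μ.succ (dH.fun_add dφu) (du _),
    pderiv_add μ.succ dH dφu, pderiv_mul μ.succ dφ (du 0),
    h.pderiv_zero_metric y hy, h.pderiv_zero_lower_zero hy, h.pderiv_zero_lower_succ hy,
    h.pderiv_zero_lower_succ hy, h.pderiv_succ_lower_zero hy, h.pderiv_succ_lower_succ hy] at e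
  have eS : ∑ l, pderiv 0 (fun z => C l z * w l.succ z) y =
      (H y + φ y * u 0 y) * ∑ l, C l y * w l.succ y + pderiv μ.succ H y * u ν.succ y
      + pderiv ν.succ H y * u μ.succ y
      - (∑ l : Fin m, pderiv l.succ H y * w l.succ y) * G y μ.succ ν.succ := by
    rw [h.lower_succ hy μ, h.lower_succ hy ν, Finset.mul_sum, Finset.mul_sum, Finset.mul_sum,
      Finset.sum_mul, ← Finset.sum_add_distrib, ← Finset.sum_add_distrib,
      ← Finset.sum_sub_distrib]
    refine Finset.sum_congr rfl fun l _ => ?_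
    rw [pderiv_mul 0 (dC l) (dw _), eC, h.pderiv_zero_upper_succ hy]
    ring
  rw [eS] at e
  simp only [hC] at e
  linear_combination e

/-- Where the spatial part of `u` vanishes on an open set, `u` is `∂ₜ` up to sign, so the expansions
`H` and `φ` agree up to sign, and so do their spatial derivatives. -/
lemma pderiv_eq_of_lower_succ_eq_zero (h : TwistedTorseFormingCoords Ω G u w φ H) {V : Set (Coord m)}
    (hV : IsOpen V) (hVΩ : V ⊆ Ω) (hu : ∀ z ∈ V, ∀ μ : Fin m, u μ.succ z = 0) (hy : y ∈ V)
    (μ : Fin m) : pderiv μ.succ H y * u 0 y + pderiv μ.succ φ y = 0 := by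
  have hw : ∀ z ∈ V, ∀ l : Fin m, w l.succ z = 0 := by
    intro z hz l
    have hz0 : (Matrix.of fun μ ν : Fin m => G z μ.succ ν.succ).mulVec
        (fun l => w l.succ z) = 0 := by
      ext μ
      simpa [Matrix.mulVec, dotProduct, h.lower_succ (hVΩ hz)] using hu z hz μ
    exact congrFun (Matrix.eq_zero_of_mulVec_eq_zero (h.posDef z (hVΩ hz)).det_pos.ne' hz0) l
  have key : ∀ z ∈ V, H z * u 0 z + φ z = 0 := by
    intro z hz
    have e := h.pderiv_succ_lower_succ (hVΩ hz) μ μ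
    rw [pderiv_eq_zero_of_forall_eq μ.succ hV hz fun z hz => hu z hz μ] at e
    simp only [hw z hz, hu z hz, mul_zero, Finset.sum_const_zero, zero_add, add_zero] at e
    have hpos : 0 < G z μ.succ μ.succ := (h.posDef z (hVΩ hz)).diag_pos (i := μ)
    exact (mul_eq_zero.1 e.symm).resolve_right hpos.ne'
  have hyΩ := hVΩ hy
  have e := pderiv_eq_zero_of_forall_eq μ.succ hV hy key
  have dHu : DifferentiableAt ℝ (fun z => H z * u 0 z) y :=
    (h.diff_expansion hyΩ).mul (h.diff_lower hyΩ 0)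
  rw [pderiv_add _ dHu (h.diff_scalar hyΩ),
    pderiv_mul _ (h.diff_expansion hyΩ) (h.diff_lower hyΩ 0),
    h.pderiv_succ_lower_zero hyΩ, hu y hy] at e
  linarith

/-- If `H` depends on time only, then the differential of `φ` is parallel to `u`. -/
lemma pderiv_scalar_parallel (hm : 2 ≤ m) (h : TwistedTorseFormingCoords Ω G u w φ H)
    (hH : ∀ z ∈ Ω, ∀ μ : Fin m, pderiv μ.succ H z = 0) (hy : y ∈ Ω) (μ : Fin m) :
    u 0 y * pderiv μ.succ φ y = pderiv 0 φ y * u μ.succ y := by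
  set p : Coord m → ℝ := fun z => pderiv 0 φ z * u μ.succ z - u 0 z * pderiv μ.succ φ z with hp
  by_contra hne
  have hpy : p y ≠ 0 := fun h0 => hne (by simp only [hp] at h0; linarith)
  -- The failure of the claim persists near `y`, where it forces the spatial part of `u` to vanish.
  have hcont : ContinuousOn p Ω :=
    (((contDiffOn_pderiv 0 h.isOpen h.smooth_scalar).mul (h.smooth_lower _)).sub
      ((h.smooth_lower 0).mul (contDiffOn_pderiv μ.succ h.isOpen h.smooth_scalar))).continuousOn
  have hV : IsOpen (Ω ∩ p ⁻¹' {0}ᶜ) := hcont.isOpen_inter_preimage h.isOpen isOpen_compl_singleton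
  have hu : ∀ z ∈ Ω ∩ p ⁻¹' {0}ᶜ, ∀ ν : Fin m, u ν.succ z = 0 := by
    rintro z ⟨hz, hpz⟩ ν
    obtain ⟨c, hc⟩ := h.exists_integrability hz
    have := mul_eq_zero_of_eq_smul_posDef hm (h.posDef z hz)
      (p := fun μ => pderiv 0 φ z * u μ.succ z - u 0 z * pderiv μ.succ φ z)
      (q := fun ν => u ν.succ z) (c := c) (fun μ ν => by
        simpa [hH z hz] using hc μ ν) μ ν
    exact (mul_eq_zero.1 this).resolve_left hpz
  have e := h.pderiv_eq_of_lower_succ_eq_zero hV Set.inter_subset_left hu ⟨hy, hpy⟩ μ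
  rw [hH y hy, zero_mul, zero_add] at e
  exact hne (by rw [e, hu y ⟨hy, hpy⟩]; ring)

/-- If the differential of `φ` is parallel to `u`, then `H` has no spatial derivatives. -/
lemma pderiv_expansion_eq_zero (hm : 2 ≤ m) (h : TwistedTorseFormingCoords Ω G u w φ H)
    (hφ : ∀ z ∈ Ω, ∀ μ : Fin m, u 0 z * pderiv μ.succ φ z = pderiv 0 φ z * u μ.succ z)
    (hy : y ∈ Ω) (μ : Fin m) : pderiv μ.succ H y = 0 := by
  by_contra hne
  -- The failure of the claim persists near `y`, where it forces the spatial part of `u` to vanish.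
  have hcont : ContinuousOn (pderiv μ.succ H) Ω :=
    (contDiffOn_pderiv μ.succ h.isOpen h.smooth_expansion).continuousOn
  have hV : IsOpen (Ω ∩ pderiv μ.succ H ⁻¹' {0}ᶜ) :=
    hcont.isOpen_inter_preimage h.isOpen isOpen_compl_singleton
  have hu : ∀ z ∈ Ω ∩ pderiv μ.succ H ⁻¹' {0}ᶜ, ∀ ν : Fin m, u ν.succ z = 0 := by
    rintro z ⟨hz, hpz⟩ ν
    obtain ⟨c, hc⟩ := h.exists_integrability hz
    have := mul_eq_zero_of_eq_smul_posDef hm (h.posDef z hz) (p := fun ν => u ν.succ z)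
      (q := fun μ => pderiv μ.succ H z) (c := c) (fun μ ν => by
        simpa [hφ z hz] using hc μ ν) ν μ
    exact (mul_eq_zero.1 this).resolve_right hpz
  have e := h.pderiv_eq_of_lower_succ_eq_zero hV Set.inter_subset_left hu ⟨hy, hne⟩ μ
  have e' := hφ y hy μ
  rw [hu y ⟨hy, hne⟩, mul_zero] at e'
  rw [(mul_eq_zero.1 e').resolve_left (h.lower_zero_ne_zero hy), add_zero] at e
  exact hne ((mul_eq_zero.1 e).resolve_right (h.lower_zero_ne_zero hy))

end TwistedTorseFormingCoords

/-! ### Passing from the manifold to a chart -/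

section Charts

variable {m : ℕ} {M : Type*} [TopologicalSpace M] [ChartedSpace (Coord m) M]
  {e : OpenPartialHomeomorph M (Coord m)} {y : Coord m}

lemma mdifferentiable_of_mem_maximalAtlas
    (he : e ∈ IsManifold.maximalAtlas (𝓡 (m + 1)) ∞ M) :
    e.MDifferentiable (𝓡 (m + 1)) (𝓡 (m + 1)) :=
  ⟨(contMDiffOn_of_mem_maximalAtlas he).mdifferentiableOn (by simp),
    (contMDiffOn_symm_of_mem_maximalAtlas he).mdifferentiableOn (by simp)⟩

lemma contDiffOn_comp_symm (he : e ∈ IsManifold.maximalAtlas (𝓡 (m + 1)) ∞ M) {φ : M → ℝ}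
    (hφ : ContMDiff (𝓡 (m + 1)) 𝓘(ℝ, ℝ) ∞ φ) :
    ContDiffOn ℝ ∞ (fun y => φ (e.symm y)) e.target :=
  contMDiffOn_iff_contDiffOn.1
    (hφ.comp_contMDiffOn (contMDiffOn_symm_of_mem_maximalAtlas he))

lemma pderiv_comp_symm (he : e ∈ IsManifold.maximalAtlas (𝓡 (m + 1)) ∞ M) (hy : y ∈ e.target)
    {φ : M → ℝ} (hφ : ContMDiff (𝓡 (m + 1)) 𝓘(ℝ, ℝ) ∞ φ) (i : Fin (m + 1)) :
    pderiv i (fun z => φ (e.symm z)) y =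
      mfderiv (𝓡 (m + 1)) 𝓘(ℝ, ℝ) φ (e.symm y) (coordVec e i y) := by
  have h := mfderiv_comp y (hφ.mdifferentiableAt (by simp) (x := e.symm y))
    ((mdifferentiable_of_mem_maximalAtlas he).mdifferentiableAt_symm hy)
  rw [mfderiv_eq_fderiv] at h
  exact DFunLike.congr_fun h (EuclideanSpace.single i (1 : ℝ) : Coord m)

/-- The coordinate vector fields form a basis of each tangent space. -/
lemma exists_basis_coordVec (he : e ∈ IsManifold.maximalAtlas (𝓡 (m + 1)) ∞ M)
    (hy : y ∈ e.target) :
    ∃ b : Module.Basis (Fin (m + 1)) ℝ (TangentSpace (𝓡 (m + 1)) (e.symm y)),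
      ∀ i, b i = coordVec e i y := by
  have hbij := (mdifferentiable_of_mem_maximalAtlas he).symm.mfderiv_bijective (x := y) hy
  let b' : Module.Basis (Fin (m + 1)) ℝ (Coord m) :=
    (EuclideanSpace.basisFun (Fin (m + 1)) ℝ).toBasis
  have hb' : ∀ i, b' i = EuclideanSpace.single i (1 : ℝ) := fun i =>
    (congrFun (OrthonormalBasis.coe_toBasis _) i).trans (EuclideanSpace.basisFun_apply _ _ i)
  let b : Module.Basis (Fin (m + 1)) ℝ (TangentSpace (𝓡 (m + 1)) y) := b'
  have hb : ∀ i, b i = (EuclideanSpace.single i (1 : ℝ) : Coord m) := hb'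
  refine ⟨b.map (LinearEquiv.ofBijective
    (mfderiv (𝓡 (m + 1)) (𝓡 (m + 1)) e.symm y).toLinearMap hbij), fun i => ?_⟩
  rw [Module.Basis.map_apply, hb]
  rfl

variable [IsManifold (𝓡 (m + 1)) ∞ M]

lemma contMDiffAt_coordVec (he : e ∈ IsManifold.maximalAtlas (𝓡 (m + 1)) ∞ M) (hy : y ∈ e.target)
    (i : Fin (m + 1)) :
    ContMDiffAt (𝓡 (m + 1)) (𝓡 (m + 1)).tangent ∞
      (fun z => (⟨e.symm z, coordVec e i z⟩ : TangentBundle (𝓡 (m + 1)) M)) y := by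
  have h1 := (contMDiffOn_symm_of_mem_maximalAtlas he).contMDiffOn_tangentMapWithin (m := ∞)
    (by simp) e.open_target.uniqueMDiffOn
  have h2 : ContMDiffOn (𝓡 (m + 1)) (𝓡 (m + 1)).tangent ∞ (fun z : Coord m =>
      (⟨z, (EuclideanSpace.single i (1 : ℝ) : Coord m)⟩ : TangentBundle (𝓡 (m + 1)) (Coord m)))
      e.target :=
    contMDiffOn_vectorSpace_iff_contDiffOn.2 contDiffOn_const
  have h3 := (h1.comp h2 (fun z hz => hz)).contMDiffAt (e.open_target.mem_nhds hy)
  refine h3.congr_of_eventuallyEq ?_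
  filter_upwards [e.open_target.mem_nhds hy] with z hz
  simp [tangentMapWithin, coordVec, mfderivWithin_of_isOpen e.open_target hz]

variable (g : LorentzMetric m M)

/-- The value of the metric on two vector fields along a chart is smooth. -/
lemma contDiffAt_metric_apply (he : e ∈ IsManifold.maximalAtlas (𝓡 (m + 1)) ∞ M)
    (hy : y ∈ e.target) {X Y : ∀ z : Coord m, TangentSpace (𝓡 (m + 1)) (e.symm z)}
    (hX : ContMDiffAt (𝓡 (m + 1)) (𝓡 (m + 1)).tangent ∞
      (fun z => (⟨e.symm z, X z⟩ : TangentBundle (𝓡 (m + 1)) M)) y)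
    (hY : ContMDiffAt (𝓡 (m + 1)) (𝓡 (m + 1)).tangent ∞
      (fun z => (⟨e.symm z, Y z⟩ : TangentBundle (𝓡 (m + 1)) M)) y) :
    ContDiffAt ℝ ∞ (fun z => g.val (e.symm z) (X z) (Y z)) y := by
  have hs : ContMDiffAt (𝓡 (m + 1)) (𝓡 (m + 1)) ∞ e.symm y :=
    contMDiffAt_symm_of_mem_maximalAtlas he hy
  have : ContMDiffAt (𝓡 (m + 1)) ((𝓡 (m + 1)).prod 𝓘(ℝ)) ∞
      (fun z ↦ Bundle.TotalSpace.mk' ℝ (E := Bundle.Trivial M ℝ) (e.symm z)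
        (g.val (e.symm z) (X z) (Y z))) y := by
    apply ContMDiffAt.clm_bundle_apply₂ (F₁ := Coord m) (F₂ := Coord m)
    · exact g.contMDiff.contMDiffAt.comp y hs
    · exact hX
    · exact hY
  rw [Bundle.contMDiffAt_totalSpace] at this
  exact contMDiffAt_iff_contDiffAt.1 this.2

lemma contDiffOn_metricMatrix (he : e ∈ IsManifold.maximalAtlas (𝓡 (m + 1)) ∞ M)
    (i j : Fin (m + 1)) : ContDiffOn ℝ ∞ (fun y => metricMatrix g e y i j) e.target :=
  fun _ hy => (contDiffAt_metric_apply g he hy (contMDiffAt_coordVec he hy i)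
    (contMDiffAt_coordVec he hy j)).contDiffWithinAt

lemma metricMatrix_symm (y : Coord m) (i j : Fin (m + 1)) :
    metricMatrix g e y i j = metricMatrix g e y j i :=
  g.symm _ _ _

lemma LorentzMetric.nondegenerate {x : M} {X : TangentSpace (𝓡 (m + 1)) x}
    (h : ∀ Y, g.val x X Y = 0) : X = 0 := by
  obtain ⟨b, hb⟩ := g.signature x
  refine b.ext_elem fun j => ?_
  have h1 := h (b j)
  rw [← b.sum_repr X, map_sum, sum_apply] at h1
  simp only [map_smul, smul_apply, hb, smul_eq_mul, mul_ite, mul_zero,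
    Finset.sum_ite_eq', Finset.mem_univ, if_true] at h1
  split_ifs at h1 <;> simpa using h1

lemma det_metricMatrix_ne_zero (he : e ∈ IsManifold.maximalAtlas (𝓡 (m + 1)) ∞ M)
    (hy : y ∈ e.target) : (metricMatrix g e y).det ≠ 0 := by
  obtain ⟨b, hb⟩ := exists_basis_coordVec he hy
  intro h0
  obtain ⟨v, hv, hv0⟩ := Matrix.exists_vecMul_eq_zero_iff.2 h0
  apply hv
  have hX : ∑ i, v i • b i = 0 := by
    apply g.nondegenerate
    intro Y
    rw [← b.sum_repr Y, map_sum, Finset.sum_eq_zero]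
    intro j _
    rw [map_smul]
    have := congrFun hv0 j
    simp only [Matrix.vecMul, dotProduct, metricMatrix, Matrix.of_apply, Pi.zero_apply,
      ← hb] at this
    rw [map_sum, sum_apply]
    simp [this]
  have := b.linearIndependent
  rw [Fintype.linearIndependent_iff] at this
  exact funext (this v hX)

variable {u : ∀ x : M, TangentSpace (𝓡 (m + 1)) x}

lemma contDiffOn_lowerComp (he : e ∈ IsManifold.maximalAtlas (𝓡 (m + 1)) ∞ M)
    (hu : IsSmoothField u) (j : Fin (m + 1)) : ContDiffOn ℝ ∞ (lowerComp g u e j) e.target :=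
  fun y hy => (contDiffAt_metric_apply g he hy
    (ContMDiffAt.comp y hu.contMDiffAt (contMDiffAt_symm_of_mem_maximalAtlas he hy))
    (contMDiffAt_coordVec he hy j)).contDiffWithinAt

lemma contDiffOn_metricMatrix_inv (he : e ∈ IsManifold.maximalAtlas (𝓡 (m + 1)) ∞ M)
    (i j : Fin (m + 1)) : ContDiffOn ℝ ∞ (fun y => (metricMatrix g e y)⁻¹ i j) e.target := by
  have hA : ∀ A : Coord m → Matrix (Fin (m + 1)) (Fin (m + 1)) ℝ,
      (∀ i j, ContDiffOn ℝ ∞ (fun y => A y i j) e.target) →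
      ContDiffOn ℝ ∞ (fun y => (A y).det) e.target := by
    intro A h
    simp only [Matrix.det_apply']
    exact ContDiffOn.sum fun σ _ => contDiffOn_const.mul (contDiffOn_prod fun i _ => h _ _)
  have hg := contDiffOn_metricMatrix g he
  have h1 : ∀ y, (metricMatrix g e y)⁻¹ i j = (metricMatrix g e y).det⁻¹ *
      ((metricMatrix g e y).updateRow j (Pi.single i 1)).det := by
    intro y
    rw [Matrix.inv_def, Matrix.smul_apply, Matrix.adjugate_apply, Ring.inverse_eq_inv', smul_eq_mul]
  simp only [h1]
  refine ((hA _ hg).inv fun y hy => det_metricMatrix_ne_zero g he hy).mul (hA _ fun a b => ?_)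
  by_cases h : a = j
  · subst h; simpa using contDiffOn_const
  · simpa [Matrix.updateRow_ne h] using hg a b

lemma contDiffOn_upperComp (he : e ∈ IsManifold.maximalAtlas (𝓡 (m + 1)) ∞ M)
    (hu : IsSmoothField u) (i : Fin (m + 1)) : ContDiffOn ℝ ∞ (upperComp g u e i) e.target :=
  ContDiffOn.sum fun j _ => (contDiffOn_metricMatrix_inv g he i j).mul (contDiffOn_lowerComp g he hu j)

lemma contDiffOn_christoffel (he : e ∈ IsManifold.maximalAtlas (𝓡 (m + 1)) ∞ M)
    (k i j : Fin (m + 1)) : ContDiffOn ℝ ∞ (christoffel g e k i j) e.target :=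
  contDiffOn_const.mul <| ContDiffOn.sum fun l _ => (contDiffOn_metricMatrix_inv g he k l).mul <|
    ((contDiffOn_pderiv i e.open_target (contDiffOn_metricMatrix g he j l)).add
      (contDiffOn_pderiv j e.open_target (contDiffOn_metricMatrix g he i l))).sub
      (contDiffOn_pderiv l e.open_target (contDiffOn_metricMatrix g he i j))

lemma christoffel_symm (y : Coord m) (k i j : Fin (m + 1)) :
    christoffel g e k i j y = christoffel g e k j i y := by
  unfold christoffel
  congr 1
  refine Finset.sum_congr rfl fun l _ => ?_
  simp only [metricMatrix_symm g _ i j]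
  ring

/-- Lowering the first index of the Christoffel symbols. -/
lemma sum_metricMatrix_mul_christoffel (he : e ∈ IsManifold.maximalAtlas (𝓡 (m + 1)) ∞ M)
    (hy : y ∈ e.target) (j i p : Fin (m + 1)) :
    ∑ l, metricMatrix g e y j l * christoffel g e l i p y =
      (1 / 2 : ℝ) * (pderiv i (fun z => metricMatrix g e z p j) y
      + pderiv p (fun z => metricMatrix g e z i j) y
      - pderiv j (fun z => metricMatrix g e z i p) y) := by
  set v : Fin (m + 1) → ℝ := fun l => (1 / 2 : ℝ) *
    (pderiv i (fun z => metricMatrix g e z p l) y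
      + pderiv p (fun z => metricMatrix g e z i l) y
      - pderiv l (fun z => metricMatrix g e z i p) y) with hv
  have hΓ : (fun l => christoffel g e l i p y) = ((metricMatrix g e y)⁻¹).mulVec v := by
    ext l
    simp only [christoffel, Matrix.mulVec, dotProduct, hv, Finset.mul_sum]
    exact Finset.sum_congr rfl fun _ _ => by ring
  have : (metricMatrix g e y).mulVec (fun l => christoffel g e l i p y) = v := by
    rw [hΓ, Matrix.mulVec_mulVec, Matrix.mul_nonsing_inv _
      (det_metricMatrix_ne_zero g he hy).isUnit, Matrix.one_mulVec]
  exact congrFun this j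

lemma sum_metricMatrix_mul_upperComp (he : e ∈ IsManifold.maximalAtlas (𝓡 (m + 1)) ∞ M)
    (hy : y ∈ e.target) (j : Fin (m + 1)) :
    ∑ l, metricMatrix g e y j l * upperComp g u e l y = lowerComp g u e j y := by
  have : (metricMatrix g e y).mulVec
      (((metricMatrix g e y)⁻¹).mulVec (fun j => lowerComp g u e j y)) =
      fun j => lowerComp g u e j y := by
    rw [Matrix.mulVec_mulVec, Matrix.mul_nonsing_inv _
      (det_metricMatrix_ne_zero g he hy).isUnit, Matrix.one_mulVec]
  exact congrFun this j

/-- The contravariant components are the coefficients with respect to the coordinate fields. -/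
lemma sum_upperComp_smul_coordVec (he : e ∈ IsManifold.maximalAtlas (𝓡 (m + 1)) ∞ M)
    (hy : y ∈ e.target) : ∑ i, upperComp g u e i y • coordVec e i y = u (e.symm y) := by
  obtain ⟨b, hb⟩ := exists_basis_coordVec he hy
  rw [← sub_eq_zero]
  apply g.nondegenerate
  intro Y
  rw [← b.sum_repr Y, map_sum, Finset.sum_eq_zero]
  intro j _
  have := sum_metricMatrix_mul_upperComp g (u := u) he hy j
  simp only [metricMatrix, Matrix.of_apply, lowerComp] at this
  rw [map_smul, hb, map_sub, sub_apply, map_sum,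
    sum_apply, ← this]
  simp only [map_smul, smul_apply, smul_eq_mul]
  rw [← Finset.sum_sub_distrib, Finset.sum_eq_zero, mul_zero]
  intro l _
  rw [g.symm _ (coordVec e l y)]; ring

variable {g} in
/-- A smooth unit time-like torse-forming field, read in a chart. -/
lemma torseFormingCoords (he : e ∈ IsManifold.maximalAtlas (𝓡 (m + 1)) ∞ M)
    (hu : IsSmoothField u) (hunit : IsTimelikeUnit g u) {φ : M → ℝ}
    (hφ : ContMDiff (𝓡 (m + 1)) 𝓘(ℝ, ℝ) ∞ φ) (htf : IsTorseForming g u φ) :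
    TorseFormingCoords e.target (metricMatrix g e) (lowerComp g u e) (upperComp g u e)
      (fun y => φ (e.symm y)) where
  isOpen := e.open_target
  smooth_metric := contDiffOn_metricMatrix g he
  smooth_lower := contDiffOn_lowerComp g he hu
  smooth_upper := contDiffOn_upperComp g he hu
  smooth_scalar := contDiffOn_comp_symm he hφ
  symm := metricMatrix_symm g
  det_ne_zero _ hy := det_metricMatrix_ne_zero g he hy
  lower_eq _ hy j := (sum_metricMatrix_mul_upperComp g he hy j).symm
  unit y hy := by
    rw [← hunit (e.symm y)]
    nth_rw 2 [← sum_upperComp_smul_coordVec g (u := u) he hy]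
    rw [map_sum]
    exact Finset.sum_congr rfl fun i _ => by
      rw [map_smul, smul_eq_mul, mul_comm]; rfl
  torse y hy i j := by
    have h1 := htf e he y hy i j
    unfold covDeriv at h1
    have h2 : ∑ k, christoffel g e k i j y * lowerComp g u e k y =
        ∑ l, (1 / 2 : ℝ) * (pderiv i (fun z => metricMatrix g e z j l) y
          + pderiv j (fun z => metricMatrix g e z i l) y
          - pderiv l (fun z => metricMatrix g e z i j) y) * upperComp g u e l y := by
      simp_rw [← sum_metricMatrix_mul_christoffel g he hy,
        ← sum_metricMatrix_mul_upperComp g (u := u) he hy, Finset.mul_sum, Finset.sum_mul]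
      rw [Finset.sum_comm]
      exact Finset.sum_congr rfl fun l _ => Finset.sum_congr rfl fun k _ => by
        rw [metricMatrix_symm g y l k]; ring
    rw [← h2, ← h1]; ring

end Charts

/-! ### The spatial gradient and the Ricci tensor -/

section Gradient

variable {m : ℕ} {M : Type*} [TopologicalSpace M] [ChartedSpace (Coord m) M]
  [IsManifold (𝓡 (m + 1)) ∞ M] {e : OpenPartialHomeomorph M (Coord m)} {y : Coord m}
  {g : LorentzMetric m M} {u : ∀ x : M, TangentSpace (𝓡 (m + 1)) x} {φ : M → ℝ}

/-- The differential of a function on `M`, as a linear form with values in `ℝ`. -/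
def differential (φ : M → ℝ) (x : M) : TangentSpace (𝓡 (m + 1)) x →L[ℝ] ℝ :=
  mfderiv (𝓡 (m + 1)) 𝓘(ℝ, ℝ) φ x

lemma spatialGradient_apply (x : M) (X : TangentSpace (𝓡 (m + 1)) x) :
    spatialGradient g u φ x X = differential φ x X
      + g.val x (u x) X * differential φ x (u x) := by
  change differential φ x (X + g.val x (u x) X • u x) = _
  rw [map_add, map_smul, smul_eq_mul]

lemma differential_apply_field (he : e ∈ IsManifold.maximalAtlas (𝓡 (m + 1)) ∞ M) (hy : y ∈ e.target)
    (hφ : ContMDiff (𝓡 (m + 1)) 𝓘(ℝ, ℝ) ∞ φ) :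
    differential φ (e.symm y) (u (e.symm y)) =
      ∑ k, upperComp g u e k y * pderiv k (fun z => φ (e.symm z)) y := by
  rw [← sum_upperComp_smul_coordVec g (u := u) he hy, map_sum]
  refine Finset.sum_congr rfl fun k _ => ?_
  rw [map_smul, pderiv_comp_symm he hy hφ, smul_eq_mul]
  rfl

lemma spatialGradient_coordVec (he : e ∈ IsManifold.maximalAtlas (𝓡 (m + 1)) ∞ M)
    (hy : y ∈ e.target) (hφ : ContMDiff (𝓡 (m + 1)) 𝓘(ℝ, ℝ) ∞ φ) (j : Fin (m + 1)) :
    spatialGradient g u φ (e.symm y) (coordVec e j y) = pderiv j (fun z => φ (e.symm z)) y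
      + lowerComp g u e j y *
        ∑ k, upperComp g u e k y * pderiv k (fun z => φ (e.symm z)) y := by
  rw [spatialGradient_apply, differential_apply_field (g := g) he hy hφ, pderiv_comp_symm he hy hφ]
  rfl

lemma spatialGradient_eq_zero_iff (he : e ∈ IsManifold.maximalAtlas (𝓡 (m + 1)) ∞ M)
    (hy : y ∈ e.target) (hφ : ContMDiff (𝓡 (m + 1)) 𝓘(ℝ, ℝ) ∞ φ) :
    (∀ X, spatialGradient g u φ (e.symm y) X = 0) ↔
      ∀ j, pderiv j (fun z => φ (e.symm z)) y + lowerComp g u e j y *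
        ∑ k, upperComp g u e k y * pderiv k (fun z => φ (e.symm z)) y = 0 := by
  simp only [← spatialGradient_coordVec he hy hφ]
  refine ⟨fun h j => h _, fun h X => ?_⟩
  obtain ⟨b, hb⟩ := exists_basis_coordVec he hy
  rw [← b.sum_repr X, spatialGradient_apply, map_sum, map_sum, Finset.sum_mul,
    ← Finset.sum_add_distrib]
  refine Finset.sum_eq_zero fun j _ => ?_
  have := h j
  rw [spatialGradient_apply, ← hb j] at this
  rw [map_smul, map_smul, smul_eq_mul, smul_eq_mul, mul_assoc, ← mul_add, this, mul_zero]

/-- The contracted Ricci identity `Rⱼₗ uˡ = m (u(φ) + φ²) uⱼ - (m - 1) vⱼ`, where `v` is the spatial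
gradient of `φ`. -/
lemma sum_ricci_mul_upperComp (he : e ∈ IsManifold.maximalAtlas (𝓡 (m + 1)) ∞ M)
    (hy : y ∈ e.target) (hu : IsSmoothField u) (hunit : IsTimelikeUnit g u)
    (hφ : ContMDiff (𝓡 (m + 1)) 𝓘(ℝ, ℝ) ∞ φ) (htf : IsTorseForming g u φ) (j : Fin (m + 1)) :
    ∑ l, ricci g e j l y * upperComp g u e l y =
      m * (differential φ (e.symm y) (u (e.symm y)) + φ (e.symm y) ^ 2)
        * lowerComp g u e j y
      - (m - 1) * spatialGradient g u φ (e.symm y) (coordVec e j y) := by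
  have h := (torseFormingCoords he hu hunit hφ htf).ricci_contract hy
    (contDiffOn_christoffel g he) (christoffel_symm g)
    (fun y hy => sum_metricMatrix_mul_christoffel g he hy) j
  rw [spatialGradient_coordVec he hy hφ, differential_apply_field (g := g) he hy hφ]
  refine h.trans ?_
  ring

/-- The field `u` is an eigenvector of the Ricci tensor exactly when the scalar `φ` has no spatial
gradient. -/
lemma isRicciEigenvector_iff (hm : 2 ≤ m) (hu : IsSmoothField u) (hunit : IsTimelikeUnit g u)
    (hφ : ContMDiff (𝓡 (m + 1)) 𝓘(ℝ, ℝ) ∞ φ) (htf : IsTorseForming g u φ) :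
    IsRicciEigenvector g u ↔ ∀ x X, spatialGradient g u φ x X = 0 := by
  constructor
  · rintro ⟨ξ, hξ⟩ x
    have he : chartAt (Coord m) x ∈ IsManifold.maximalAtlas (𝓡 (m + 1)) ∞ M :=
      IsManifold.chart_mem_maximalAtlas x
    set e := chartAt (Coord m) x
    have hx : x ∈ e.source := mem_chart_source _ x
    have hy : e x ∈ e.target := e.map_source hx
    rw [← e.left_inv hx, spatialGradient_eq_zero_iff he hy hφ]
    set y := e x
    have h := torseFormingCoords he hu hunit hφ htf
    set A : ℝ := m * (differential φ (e.symm y) (u (e.symm y))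
      + φ (e.symm y) ^ 2)
    set D := ∑ k, upperComp g u e k y * pderiv k (fun z => φ (e.symm z)) y with hD
    have h1 : ∀ j, (m - 1 : ℝ) * (pderiv j (fun z => φ (e.symm z)) y + lowerComp g u e j y * D) =
        (A - ξ (e.symm y)) * lowerComp g u e j y := by
      intro j
      have := hξ e he y hy j
      rw [sum_ricci_mul_upperComp he hy hu hunit hφ htf, spatialGradient_coordVec he hy hφ] at this
      linear_combination -this
    -- The spatial gradient is orthogonal to `u`, so contracting with `u` determines `ξ`.
    have h2 : A - ξ (e.symm y) = 0 := by
      have h3 : ∑ j, (m - 1 : ℝ) * (pderiv j (fun z => φ (e.symm z)) y + lowerComp g u e j y * D)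
          * upperComp g u e j y = ∑ j, (A - ξ (e.symm y)) * lowerComp g u e j y
          * upperComp g u e j y := Finset.sum_congr rfl fun j _ => by rw [h1 j]
      have h4 : ∑ j, (m - 1 : ℝ) * (pderiv j (fun z => φ (e.symm z)) y + lowerComp g u e j y * D)
          * upperComp g u e j y = (m - 1) *
            (D + D * ∑ j, lowerComp g u e j y * upperComp g u e j y) := by
        nth_rw 2 [hD]
        rw [Finset.mul_sum, ← Finset.sum_add_distrib, Finset.mul_sum]
        exact Finset.sum_congr rfl fun _ _ => by ring
      simp only [mul_assoc] at h3 h4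
      rw [h4, ← Finset.mul_sum, h.unit y hy] at h3
      linarith
    intro j
    have hm' : (m - 1 : ℝ) ≠ 0 := by
      have : (2 : ℝ) ≤ m := by exact_mod_cast hm
      linarith
    have := h1 j
    rw [h2, zero_mul] at this
    exact (mul_eq_zero.1 this).resolve_left hm'
  · intro hv
    refine ⟨fun x => m * (differential φ x (u x) + φ x ^ 2),
      fun e he y hy j => ?_⟩
    rw [sum_ricci_mul_upperComp he hy hu hunit hφ htf, hv]
    ring

end Gradient

/-! ### Splitting the warping factor -/

section Product

variable {m : ℕ}

/-- The identification of `ℝ × ℝᵐ` with the coordinate space of spacetime. -/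
def ofTimeSpace (m : ℕ) : (ℝ × SpaceCoord m) →L[ℝ] Coord m :=
  LinearMap.toContinuousLinearMap
    { toFun := fun p => WithLp.toLp 2 (Fin.cons p.1 p.2 : Fin (m + 1) → ℝ)
      map_add' := fun p q => by ext i; refine Fin.cases ?_ (fun μ => ?_) i <;> simp
      map_smul' := fun a p => by ext i; refine Fin.cases ?_ (fun μ => ?_) i <;> simp }

@[simp] lemma ofTimeSpace_zero (p : ℝ × SpaceCoord m) : ofTimeSpace m p 0 = p.1 := rfl

@[simp] lemma ofTimeSpace_succ (p : ℝ × SpaceCoord m) (μ : Fin m) :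
    ofTimeSpace m p μ.succ = p.2 μ := rfl

@[simp] lemma spacePart_ofTimeSpace (p : ℝ × SpaceCoord m) :
    spacePart (ofTimeSpace m p) = p.2 := by
  ext μ; simp [spacePart]

lemma ofTimeSpace_time : ofTimeSpace m (1, 0) = EuclideanSpace.single 0 1 := by
  ext i; refine Fin.cases ?_ (fun μ => ?_) i <;> simp

lemma ofTimeSpace_single (μ : Fin m) :
    ofTimeSpace m (0, EuclideanSpace.single μ 1) = EuclideanSpace.single μ.succ 1 := by
  ext i; refine Fin.cases ?_ (fun ν => ?_) i
  · simp
  · simp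

lemma contDiff_spacePart : ContDiff ℝ ∞ (spacePart : Coord m → SpaceCoord m) := by
  rw [contDiff_euclidean]
  intro μ
  simp only [spacePart]
  fun_prop

lemma hasDerivAt_time_slice {F : Coord m → ℝ} {t : ℝ} {x : SpaceCoord m}
    (hF : DifferentiableAt ℝ F (ofTimeSpace m (t, x))) :
    HasDerivAt (fun s => F (ofTimeSpace m (s, x))) (pderiv 0 F (ofTimeSpace m (t, x))) t := by
  have h1 : HasDerivAt (fun s : ℝ => ofTimeSpace m (s, x)) (EuclideanSpace.single 0 1) t := by
    have := (ofTimeSpace m).hasFDerivAt.comp_hasDerivAt t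
      ((hasDerivAt_id t).prodMk (hasDerivAt_const t x))
    rwa [ofTimeSpace_time] at this
  exact hF.hasFDerivAt.comp_hasDerivAt t h1

lemma eq_of_pderiv_succ_eq_zero {F : Coord m → ℝ} {t r : ℝ} {x₀ x : SpaceCoord m}
    (hF : ∀ z ∈ Metric.ball x₀ r, DifferentiableAt ℝ F (ofTimeSpace m (t, z)))
    (h0 : ∀ z ∈ Metric.ball x₀ r, ∀ μ : Fin m, pderiv μ.succ F (ofTimeSpace m (t, z)) = 0)
    (hx : x ∈ Metric.ball x₀ r) : F (ofTimeSpace m (t, x)) = F (ofTimeSpace m (t, x₀)) := by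
  have hder : ∀ z ∈ Metric.ball x₀ r,
      HasFDerivAt (fun z => F (ofTimeSpace m (t, z))) (0 : SpaceCoord m →L[ℝ] ℝ) z := by
    intro z hz
    have h1 : HasFDerivAt (fun z : SpaceCoord m => ofTimeSpace m (t, z))
        ((ofTimeSpace m).comp (ContinuousLinearMap.inr ℝ ℝ (SpaceCoord m))) z :=
      (ofTimeSpace m).hasFDerivAt.comp z (hasFDerivAt_prodMk_right t z)
    have h2 := (hF z hz).hasFDerivAt.comp z h1
    refine h2.congr_fderiv (ContinuousLinearMap.coe_injective
      ((EuclideanSpace.basisFun (Fin m) ℝ).toBasis.ext (M₁ := ℝ) fun μ => ?_))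
    simpa [ofTimeSpace_single, pderiv] using h0 z hz μ
  refine (convex_ball x₀ r).is_const_of_fderivWithin_eq_zero (𝕜 := ℝ)
    (fun z hz => (hder z hz).differentiableAt.differentiableWithinAt) (fun z hz => ?_) hx
    (Metric.mem_ball_self (dist_nonneg.trans_lt hx))
  rw [fderivWithin_of_isOpen Metric.isOpen_ball hz, (hder z hz).fderiv]

/-- If `∂ₜF / F` does not depend on the spatial variables, then `F` is a product of a function of
time and a function of space. -/
lemma eq_mul_of_pderiv_expansion_eq_zero {Ω : Set (Coord m)} (hΩ : IsOpen Ω) {F : Coord m → ℝ}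
    (hF : ContDiffOn ℝ ∞ F Ω) (hpos : ∀ y ∈ Ω, 0 < F y)
    (hH : ∀ y ∈ Ω, ∀ μ : Fin m, pderiv μ.succ (fun z => pderiv 0 F z / F z) y = 0)
    {I : Set ℝ} (hI : I.OrdConnected) (hIo : IsOpen I) {x₀ x : SpaceCoord m} {r t₀ t : ℝ}
    (hsub : ∀ s ∈ I, ∀ z ∈ Metric.ball x₀ r, ofTimeSpace m (s, z) ∈ Ω)
    (ht₀ : t₀ ∈ I) (ht : t ∈ I) (hx : x ∈ Metric.ball x₀ r) :
    F (ofTimeSpace m (t, x)) = F (ofTimeSpace m (t, x₀)) *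
      (F (ofTimeSpace m (t₀, x)) / F (ofTimeSpace m (t₀, x₀))) := by
  have hx₀ : x₀ ∈ Metric.ball x₀ r := Metric.mem_ball_self (dist_nonneg.trans_lt hx)
  have dF : ∀ y ∈ Ω, DifferentiableAt ℝ F y := fun y hy =>
    ContDiffOn.differentiableAt_of_isOpen hΩ hF hy
  have dH : ∀ y ∈ Ω, DifferentiableAt ℝ (fun z => pderiv 0 F z / F z) y := fun y hy =>
    ContDiffOn.differentiableAt_of_isOpen hΩ
      ((contDiffOn_pderiv 0 hΩ hF).div hF fun z hz => (hpos z hz).ne') hy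
  have hHx : ∀ s ∈ I, pderiv 0 F (ofTimeSpace m (s, x)) * F (ofTimeSpace m (s, x₀)) =
      pderiv 0 F (ofTimeSpace m (s, x₀)) * F (ofTimeSpace m (s, x)) := by
    intro s hs
    have := eq_of_pderiv_succ_eq_zero (fun z hz => dH _ (hsub s hs z hz))
      (fun z hz => hH _ (hsub s hs z hz)) hx
    rwa [div_eq_div_iff (hpos _ (hsub s hs x hx)).ne' (hpos _ (hsub s hs x₀ hx₀)).ne'] at this
  -- The quotient of the two time slices has derivative zero on the interval.
  have hder : ∀ s ∈ I, HasDerivAt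
      (fun s => F (ofTimeSpace m (s, x)) / F (ofTimeSpace m (s, x₀))) 0 s := by
    intro s hs
    have h := (hasDerivAt_time_slice (dF _ (hsub s hs x hx))).fun_div
      (hasDerivAt_time_slice (dF _ (hsub s hs x₀ hx₀))) (hpos _ (hsub s hs x₀ hx₀)).ne'
    refine h.congr_deriv ?_
    rw [hHx s hs]
    ring
  have hc := hIo.is_const_of_deriv_eq_zero hI.isPreconnected
    (fun s hs => (hder s hs).differentiableAt.differentiableWithinAt)
    (fun s hs => (hder s hs).deriv) ht ht₀
  change _ / _ = _ / _ at hc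
  rw [← hc, mul_div_cancel₀ _ (hpos _ (hsub t ht x₀ hx₀)).ne']

end Product

section TwistedChart

variable {m : ℕ} {M : Type*} [TopologicalSpace M] [ChartedSpace (Coord m) M]
  [IsManifold (𝓡 (m + 1)) ∞ M] {e : OpenPartialHomeomorph M (Coord m)}
  {g : LorentzMetric m M} {u : ∀ x : M, TangentSpace (𝓡 (m + 1)) x} {φ : M → ℝ}
  {I : Set ℝ} {U : Set (SpaceCoord m)} {f : ℝ → SpaceCoord m → ℝ}
  {gs : SpaceCoord m → Matrix (Fin m) (Fin m) ℝ}

lemma IsTwistedChart.contDiffOn_factor (h : IsTwistedChart g e I U f gs) :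
    ContDiffOn ℝ ∞ (fun y => f (y 0) (spacePart y)) e.target := by
  obtain ⟨-, -, -, -, htar, -, hf, -⟩ := h
  refine hf.comp (t := I ×ˢ U) (f := fun y : Coord m => (y 0, spacePart y)) ?_ ?_
  · exact (ContDiff.prodMk (by fun_prop) contDiff_spacePart).contDiffOn
  · intro y hy
    rw [htar] at hy
    exact hy

lemma IsTwistedChart.factor_pos (h : IsTwistedChart g e I U f gs) {y : Coord m}
    (hy : y ∈ e.target) : 0 < f (y 0) (spacePart y) := by
  obtain ⟨-, -, -, -, htar, hpos, -⟩ := h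
  rw [htar] at hy
  exact hpos _ hy.1 _ hy.2

lemma IsTwistedChart.twistedTorseFormingCoords (h : IsTwistedChart g e I U f gs)
    (hu : IsSmoothField u) (hunit : IsTimelikeUnit g u)
    (hφ : ContMDiff (𝓡 (m + 1)) 𝓘(ℝ, ℝ) ∞ φ) (htf : IsTorseForming g u φ) :
    TwistedTorseFormingCoords e.target (metricMatrix g e) (lowerComp g u e) (upperComp g u e)
      (fun y => φ (e.symm y))
      (fun y => pderiv 0 (fun z => f (z 0) (spacePart z)) y / f (y 0) (spacePart y)) := by
  have hF := h.contDiffOn_factor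
  have hpos : ∀ y ∈ e.target, 0 < f (y 0) (spacePart y) := fun y hy => h.factor_pos hy
  obtain ⟨he, -, -, hU, htar, -, -, hgpos, hgs, hmet⟩ := h
  refine ⟨torseFormingCoords he hu hunit hφ htf, fun y hy => (hmet y hy).1,
    fun y hy => (hmet y hy).2.1, ?_, fun y hy μ ν => ?_, fun y hy => ?_⟩
  · exact (contDiffOn_pderiv 0 e.open_target hF).div hF fun y hy => (hpos y hy).ne'
  · have hyU : spacePart y ∈ U := by rw [htar] at hy; exact hy.2
    have dgs : DifferentiableAt ℝ (fun x => gs x μ ν) (spacePart y) :=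
      ((hgs μ ν).contDiffAt (hU.mem_nhds hyU)).differentiableAt (by simp)
    have dsp : DifferentiableAt ℝ (spacePart : Coord m → SpaceCoord m) y :=
      contDiff_spacePart.contDiffAt.differentiableAt (by simp)
    have dgsp : DifferentiableAt ℝ (fun z : Coord m => gs (spacePart z) μ ν) y :=
      dgs.comp y dsp
    have hy' : ofTimeSpace m (y 0, spacePart y) = y := by
      ext i; refine Fin.cases ?_ (fun ν => ?_) i
      · simp
      · simp [spacePart]
    -- The spatial metric does not depend on time.
    have h0 : pderiv 0 (fun z : Coord m => gs (spacePart z) μ ν) y = 0 := by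
      have h1 := hasDerivAt_time_slice (F := fun z : Coord m => gs (spacePart z) μ ν)
        (t := y 0) (x := spacePart y) (by rw [hy']; exact dgsp)
      rw [hy'] at h1
      simp only [spacePart_ofTimeSpace] at h1
      exact h1.unique (hasDerivAt_const _ _)
    have dF := ContDiffOn.differentiableAt_of_isOpen e.open_target hF hy
    have dFF : DifferentiableAt ℝ
      (fun z : Coord m => f (z 0) (spacePart z) * f (z 0) (spacePart z)) y := dF.mul dF
    rw [pderiv_congr 0 e.open_target hy (F' := fun z => f (z 0) (spacePart z) *
      f (z 0) (spacePart z) * gs (spacePart z) μ ν) (fun z hz => by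
        simpa only [pow_two] using (hmet z hz).2.2 μ ν), pderiv_mul 0 dFF dgsp,
      pderiv_mul 0 dF dF, h0, (hmet y hy).2.2]
    have := (hpos y hy).ne'
    field_simp
    ring
  · have hyU : spacePart y ∈ U := by rw [htar] at hy; exact hy.2
    have : (Matrix.of fun μ ν : Fin m => metricMatrix g e y μ.succ ν.succ) =
        (f (y 0) (spacePart y) ^ 2) • gs (spacePart y) := by
      ext μ ν; simp [(hmet y hy).2.2]
    rw [this]
    exact (hgpos _ hyU).smul (pow_pos (hpos y hy) 2)

/-- In a chart the vanishing of the spatial gradient says that `dφ` is parallel to `u`. -/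
lemma spatialGradient_eq_zero_iff_parallel {H : Coord m → ℝ} {y : Coord m}
    (he : e ∈ IsManifold.maximalAtlas (𝓡 (m + 1)) ∞ M) (hy : y ∈ e.target)
    (hφ : ContMDiff (𝓡 (m + 1)) 𝓘(ℝ, ℝ) ∞ φ)
    (h : TwistedTorseFormingCoords e.target (metricMatrix g e) (lowerComp g u e) (upperComp g u e)
      (fun y => φ (e.symm y)) H) :
    (∀ X, spatialGradient g u φ (e.symm y) X = 0) ↔
      ∀ μ : Fin m, lowerComp g u e 0 y * pderiv μ.succ (fun z => φ (e.symm z)) y =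
        pderiv 0 (fun z => φ (e.symm z)) y * lowerComp g u e μ.succ y := by
  rw [spatialGradient_eq_zero_iff he hy hφ]
  constructor
  · intro hv μ
    linear_combination lowerComp g u e 0 y * hv μ.succ - lowerComp g u e μ.succ y * hv 0
  · intro hp
    have h0 := h.lower_zero_ne_zero hy
    set c := pderiv 0 (fun z => φ (e.symm z)) y / lowerComp g u e 0 y with hc
    have hd : ∀ i, pderiv i (fun z => φ (e.symm z)) y = c * lowerComp g u e i y := by
      refine Fin.cases ?_ fun μ => ?_
      · rw [hc]; field_simp
      · rw [hc, div_mul_eq_mul_div, ← hp μ]; field_simp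
    intro j
    have : ∑ k, upperComp g u e k y * (c * lowerComp g u e k y) = -c := by
      have hun := h.unit y hy
      calc _ = c * ∑ k, lowerComp g u e k y * upperComp g u e k y := by
            rw [Finset.mul_sum]; exact Finset.sum_congr rfl fun _ _ => by ring
        _ = -c := by rw [hun]; ring
    simp only [hd, this]
    ring

/-- In a chart in which the warping factor depends on time only, the scalar of any unit
torse-forming field has no spatial gradient. -/
lemma IsTwistedChart.spatialGradient_eq_zero (hm : 2 ≤ m) {f : ℝ → ℝ}
    (h : IsTwistedChart g e I U (fun t _ => f t) gs)
    (hu : IsSmoothField u) (hunit : IsTimelikeUnit g u)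
    (hφ : ContMDiff (𝓡 (m + 1)) 𝓘(ℝ, ℝ) ∞ φ) (htf : IsTorseForming g u φ) {y : Coord m}
    (hy : y ∈ e.target) (X : TangentSpace (𝓡 (m + 1)) (e.symm y)) :
    spatialGradient g u φ (e.symm y) X = 0 := by
  have hT := h.twistedTorseFormingCoords hu hunit hφ htf
  have hF := h.contDiffOn_factor
  have hpos : ∀ y ∈ e.target, 0 < f (y 0) := fun y hy => h.factor_pos hy
  refine (spatialGradient_eq_zero_iff_parallel h.1 hy hφ hT).2
    (fun μ => hT.pderiv_scalar_parallel hm ?_ hy μ) X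
  intro z hz μ
  have dF := fun z (hz : z ∈ e.target) => ContDiffOn.differentiableAt_of_isOpen e.open_target hF hz
  have hF0 : ∀ z ∈ e.target, pderiv μ.succ (fun y : Coord m => f (y 0)) z = 0 := by
    intro z hz
    -- Along the coordinate line of `∂_μ` the function is constant.
    have h1 : HasDerivAt (fun s : ℝ => z + s • (EuclideanSpace.single μ.succ (1 : ℝ) : Coord m))
        (EuclideanSpace.single μ.succ (1 : ℝ) : Coord m) 0 := by
      simpa using ((hasDerivAt_id (0 : ℝ)).smul_const
        (EuclideanSpace.single μ.succ (1 : ℝ) : Coord m)).const_add z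
    have h2 : HasFDerivAt (fun y : Coord m => f (y 0)) (fderiv ℝ (fun y : Coord m => f (y 0)) z)
        (z + (0 : ℝ) • (EuclideanSpace.single μ.succ (1 : ℝ) : Coord m)) := by
      simpa using (dF z hz).hasFDerivAt
    have h3 := h2.comp_hasDerivAt 0 h1
    refine h3.unique ?_
    have : ((fun y : Coord m => f (y 0)) ∘ fun s : ℝ =>
        z + s • (EuclideanSpace.single μ.succ (1 : ℝ) : Coord m)) = fun _ => f (z 0) := by
      ext s; simp
    rw [this]
    exact hasDerivAt_const _ _
  have e1 : pderiv μ.succ (pderiv 0 fun y : Coord m => f (y 0)) z = 0 := by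
    rw [pderiv_comm _ _ e.open_target hF hz]
    exact pderiv_eq_zero_of_forall_eq 0 e.open_target hz hF0
  have e2 : pderiv μ.succ (pderiv 0 fun y : Coord m => f (y 0)) z =
      pderiv μ.succ (fun y => pderiv 0 (fun z => f (z 0)) y / f (y 0) * f (y 0)) z :=
    pderiv_congr _ e.open_target hz fun w hw => (div_mul_cancel₀ _ (hpos w hw).ne').symm
  rw [pderiv_mul _ (hT.diff_expansion hz) (dF z hz), hF0 z hz, mul_zero, add_zero, e1] at e2
  exact (mul_eq_zero.1 e2.symm).resolve_right (hpos z hz).ne'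

/-- If the spatial gradient of `φ` vanishes, each twisted chart becomes a warped one after shrinking
its spatial part to a ball and rescaling the spatial metric. -/
lemma IsTwistedChart.exists_warped (hm : 2 ≤ m) (h : IsTwistedChart g e I U f gs)
    (hu : IsSmoothField u) (hunit : IsTimelikeUnit g u)
    (hφ : ContMDiff (𝓡 (m + 1)) 𝓘(ℝ, ℝ) ∞ φ) (htf : IsTorseForming g u φ)
    (hv : ∀ x X, spatialGradient g u φ x X = 0) {x : M} (hx : x ∈ e.source) :
    ∃ e' I U, ∃ f : ℝ → ℝ, ∃ gs, x ∈ e'.source ∧ IsTwistedChart g e' I U (fun t _ => f t) gs := by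
  have hT := h.twistedTorseFormingCoords hu hunit hφ htf
  have hF := h.contDiffOn_factor
  have hFpos : ∀ y ∈ e.target, 0 < f (y 0) (spacePart y) := fun y hy => h.factor_pos hy
  have hH : ∀ y ∈ e.target, ∀ μ : Fin m, pderiv μ.succ (fun y =>
      pderiv 0 (fun z => f (z 0) (spacePart z)) y / f (y 0) (spacePart y)) y = 0 :=
    fun y hy μ => hT.pderiv_expansion_eq_zero hm (fun z hz =>
      (spatialGradient_eq_zero_iff_parallel h.1 hz hφ hT).1 (hv _)) hy μ
  obtain ⟨he, hIo, hI, hU, htar, hpos, hf, hgpos, hgs, hmet⟩ := h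
  have hy : e x ∈ e.target := e.map_source hx
  set t₀ := e x 0
  set x₀ := spacePart (e x)
  obtain ⟨ht₀, hx₀⟩ : t₀ ∈ I ∧ x₀ ∈ U := by rw [htar] at hy; exact hy
  obtain ⟨r, hr, hball⟩ := Metric.isOpen_iff.1 hU x₀ hx₀
  have hsub : ∀ s ∈ I, ∀ z ∈ Metric.ball x₀ r, ofTimeSpace m (s, z) ∈ e.target := by
    intro s hs z hz
    rw [htar]
    exact ⟨by simpa using hs, by simpa using hball hz⟩
  have hsplit : ∀ t ∈ I, ∀ z ∈ Metric.ball x₀ r, f t z = f t x₀ * (f t₀ z / f t₀ x₀) := by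
    intro t ht z hz
    simpa using eq_mul_of_pderiv_expansion_eq_zero e.open_target hF hFpos hH hI hIo hsub ht₀ ht hz
  have hBo : IsOpen (spacePart ⁻¹' Metric.ball x₀ r : Set (Coord m)) :=
    Metric.isOpen_ball.preimage contDiff_spacePart.continuous
  set S : Set M := e.source ∩ e ⁻¹' (spacePart ⁻¹' Metric.ball x₀ r)
  have hSo : IsOpen S := e.isOpen_inter_preimage hBo
  have htar' : (e.restr S).target = {y | y 0 ∈ I ∧ spacePart y ∈ Metric.ball x₀ r} := by
    rw [e.restr_target, hSo.interior_eq]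
    ext y
    constructor
    · rintro ⟨hy1, hy2⟩
      have h2 : spacePart (e (e.symm y)) ∈ Metric.ball x₀ r := hy2.2
      rw [e.right_inv hy1] at h2
      rw [htar] at hy1
      exact ⟨hy1.1, h2⟩
    · rintro ⟨hy1, hy2⟩
      have hyt : y ∈ e.target := by rw [htar]; exact ⟨hy1, hball hy2⟩
      refine ⟨hyt, e.map_target hyt, ?_⟩
      change spacePart (e (e.symm y)) ∈ Metric.ball x₀ r
      rwa [e.right_inv hyt]
  have hsub' : ∀ {y}, y ∈ (e.restr S).target → y ∈ e.target := by
    intro y hy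
    rw [htar'] at hy
    rw [htar]
    exact ⟨hy.1, hball hy.2⟩
  have hfx : ∀ z ∈ Metric.ball x₀ r, 0 < f t₀ z / f t₀ x₀ := fun z hz =>
    div_pos (hpos _ ht₀ _ (hball hz)) (hpos _ ht₀ _ hx₀)
  refine ⟨e.restr S, I, Metric.ball x₀ r, fun t => f t x₀,
    fun z => (f t₀ z / f t₀ x₀) ^ 2 • gs z, ?_, ?_, hIo, hI, Metric.isOpen_ball, htar',
    fun t ht _ _ => hpos t ht x₀ hx₀, ?_, fun z hz => (hgpos z (hball hz)).smul
      (pow_pos (hfx z hz) 2), fun μ ν => ?_, fun y hy => ?_⟩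
  · rw [e.restr_source, hSo.interior_eq]
    exact ⟨hx, hx, Metric.mem_ball_self hr⟩
  · exact restr_mem_maximalAtlas _ he hSo
  · exact hf.comp (f := fun p : ℝ × SpaceCoord m => (p.1, x₀)) (by fun_prop)
      fun p hp => ⟨hp.1, hx₀⟩
  · have hft₀ : ContDiffOn ℝ ∞ (fun z => f t₀ z) (Metric.ball x₀ r) :=
      hf.comp (f := fun z : SpaceCoord m => (t₀, z)) (by fun_prop) fun z hz => ⟨ht₀, hball hz⟩
    exact ((hft₀.div_const _).pow 2).mul ((hgs μ ν).mono hball)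
  · obtain ⟨h1, h2, h3⟩ := hmet y (hsub' hy)
    refine ⟨h1, h2, fun μ ν => (h3 μ ν).trans ?_⟩
    rw [htar'] at hy
    rw [hsplit _ hy.1 _ hy.2, mul_pow, mul_assoc]
    rfl

end TwistedChart

end LorentzGeometry

end

theorem mainTheorem5 (m : ℕ) (hm : 2 ≤ m) (M : Type*) [TopologicalSpace M]
    [ChartedSpace (LorentzGeometry.Coord m) M] [IsManifold (𝓡 (m + 1)) ∞ M]
    (g : LorentzGeometry.LorentzMetric m M) (hg : LorentzGeometry.IsTwisted g)
    (u : ∀ x : M, TangentSpace (𝓡 (m + 1)) x) (hu : LorentzGeometry.IsSmoothField u)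
    (hunit : LorentzGeometry.IsTimelikeUnit g u)
    (φ : M → ℝ) (hφ : ContMDiff (𝓡 (m + 1)) 𝓘(ℝ, ℝ) ∞ φ)
    (htf : LorentzGeometry.IsTorseForming g u φ) :
    (LorentzGeometry.IsGRW g ↔
      ∀ (x : M) (X : TangentSpace (𝓡 (m + 1)) x),
        LorentzGeometry.spatialGradient g u φ x X = 0) ∧
    (LorentzGeometry.IsGRW g ↔ LorentzGeometry.IsRicciEigenvector g u) := by
  have key : LorentzGeometry.IsGRW g ↔ ∀ (x : M) (X : TangentSpace (𝓡 (m + 1)) x),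
      LorentzGeometry.spatialGradient g u φ x X = 0 := by
    constructor
    · intro h x
      obtain ⟨e, I, U, f, gs, hx, hc⟩ := h x
      rw [← e.left_inv hx]
      exact hc.spatialGradient_eq_zero hm hu hunit hφ htf (e.map_source hx)
    · intro hv x
      obtain ⟨e, I, U, f, gs, hx, hc⟩ := hg x
      exact hc.exists_warped hm hu hunit hφ htf hv hx
  exact ⟨key, key.trans (LorentzGeometry.isRicciEigenvector_iff hm hu hunit hφ htf).symm⟩
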